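/- Let $P=(p_{xy})$ be an ergodic (irreducible and aperiodic) reversible Markov chain on a finite set $X$ with at least two elements, with stationary distribution $\pi$, time reversal $P^*=(p^*_{xy})$, $\pi_xp_{xy}=\pi_yp^*_{yx}$ (so $P^*=P$), and eigenvalue gap $\delta=1-|\lambda|$, $\lambda$ being an eigenvalue of second largest magnitude. Let $M\subseteq X$ be non-empty and $\varepsilon=\sum_{x\in M}\pi_x$, and suppose that $\varepsilon$ is known. Put $|p_x\rangle=\sum_y\sqrt{p_{xy}}\,|y\rangle$, $|p^*_y\rangle=\sum_x\sqrt{p^*_{yx}}\,|x\rangle$, $|\pi\rangle=\sum_x\sqrt{\pi_x}\,|x\rangle|p_x\rangle$, $\mathcal A=\mathrm{Span}\{|x\rangle|p_x\rangle: x\in X\}$, $\mathcal B=\mathrm{Span}\{|p^*_y\rangle|y\rangle: y\in X\}$, and $W(P)=\mathrm{ref}(\mathcal B)\,\mathrm{ref}(\mathcal A)$ on $\mathbb C^{X}\otimes\mathbb C^X$, where $\mathrm{ref}(\mathcal K)=2\Pi_{\mathcal K}-\mathrm{Id}$. Let $\Delta=2\theta$ be the phase gap, where $\theta$ is the smallest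 angle in $(0,\pi/2]$ such that $\cos\theta$ is a singular value of $D(P)=(\sqrt{p_{xy}p^*_{yx}})$. Fix an element $\bar 0\in X$. The available operations on the two vertex registers and on ancilla qubits are: unitary updates extending $|x\rangle|\bar0\rangle\mapsto|x\rangle|p_x\rangle$ and $|\bar0\rangle|y\rangle\mapsto|p^*_y\rangle|y\rangle$, and their inverses (cost $\mathsf U$ each); the phase flip $|x\rangle|y\rangle\mapsto-|x\rangle|y\rangle$ for $x\in M$ (cost $\mathsf C$, as is the test whether an observed $x$ is in $M$); preparation of $\sum_x\sqrt{\pi_x}|x\rangle|\bar0\rangle$ (cost $\mathsf S$); and the operations not involving the data, namely the reflections through $\mathbb C^X\otimes|\bar0\rangle$ and $|\bar0\rangle\otimes\mathbb C^X$ controlled by an ancilla qubit, Hadamard gates on ancilla qubits, and the reflection of the ancilla register through $|0\cdots0\rangle$ (cost $u_0$ each, where $0\le u_0\le\mathsf U$; $u_0=1$ for unit-cost accounting). Also $\mathsf S,\mathsf C\ge0$. Let $R(P)$ be the following circuit on $k\lceil\log_2(4\pi/\Delta)\rceil$ ancilla qubits: $k$ runs of phase estimation of $W(P)$ with $\lceil\log_2(4\pi/\Delta)\rceil$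 bits each (the final inverse Fourier transform may be replaced by Hadamard gates), a sign flip unless all the estimates are zero, and the inverse of the phase estimations. Quantum Search$(P)$ is the procedure: prepare $|\pi\rangle$ by setup and one update; repeat $t$ times: flip the phase of every $|x\rangle|y\rangle$ with $x\in M$, then apply $R(P)$; finally observe the first register and output it if it is in $M$. Then for every $\eta>0$ there are a constant $c$, an integer $r\ge1$, and choices of $k=k(\varepsilon)\ge 1$ and $t=t(\varepsilon)$ with $$k\le c\,\Bigl(1+\log\tfrac1{\sqrt\varepsilon}\Bigr),\qquad t\le \frac{c}{\sqrt\varepsilon},$$ all depending on $\eta$ only (and, for $k,t$, on $\varepsilon$), but not on $X$, $P$, $M$ or the costs, such that for all $X,P,M$ as above: 1. The circuit for the controlled walk, built from the listed operations, implements controlled-$W(P)$. With the ancillas initially $|0\cdots0\rangle$, $R(P)|\pi\rangle=|\pi\rangle$, and $\|(R(P)+\mathrm{Id})|\psi\rangle\|\le2^{-k}\|\psi\|$ for every $|\psi\rangle\in\mathcal A+\mathcal B$ orthogonal to $|\pi\rangle$. 2. Quantum Search$(P)$ outputs a marked element with probability at least $\max(\varepsilon,1-\varepsilon)-\eta$;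 and $r$ independent runs of it all fail with probability at most $\eta$. 3. The total cost of these $r$ runs (in particular, of a single one) is at most $$c\left(\mathsf S+\frac1{\sqrt\varepsilon}\left(\frac1{\sqrt\delta}\Bigl(1+\log\frac1{\sqrt\varepsilon}\Bigr)\mathsf U+\mathsf C\right)\right).$$ -/

import Mathlib

open scoped Matrix Kronecker

namespace QuantumWalk

noncomputable section

/-! ## Classical Markov chains on a finite set -/

/-- Every state has period one: `1` is the only common divisor of its return times. -/
def IsAperiodic {X : Type*} [Fintype X] [DecidableEq X] (P : Matrix X X ℝ) : Prop :=
  ∀ (x : X) (d : ℕ), (∀ n : ℕ, 1 ≤ n → 0 < (P ^ n) x x → d ∣ n) → d = 1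

/-- An ergodic Markov chain: a stochastic matrix that is irreducible and aperiodic. -/
structure IsErgodicChain {X : Type*} [Fintype X] [DecidableEq X] (P : Matrix X X ℝ) : Prop where
  stochastic : P ∈ Matrix.rowStochastic ℝ X
  irreducible : P.IsIrreducible
  aperiodic : IsAperiodic P

/-- `π` is a stationary probability distribution of `P`. -/
structure IsStationaryDist {X : Type*} [Fintype X] (P : Matrix X X ℝ) (π : X → ℝ) : Prop where
  nonneg : ∀ x, 0 ≤ π x
  sum_eq_one : ∑ x, π x = 1
  invariant : π ᵥ* P = π

/-- The time-reversed chain `P*`, given by `π x * P x y = π y * P* y x`. -/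
def timeReversal {X : Type*} (P : Matrix X X ℝ) (π : X → ℝ) : Matrix X X ℝ :=
  Matrix.of fun y x => π x * P x y / π y

/-- The chain is reversible if it equals its time reversal. -/
def IsReversibleChain {X : Type*} (P : Matrix X X ℝ) (π : X → ℝ) : Prop :=
  timeReversal P π = P

/-- The eigenvalue gap `1 - |λ|`, where `λ` is a (complex) eigenvalue of second largest magnitude.
(For an irreducible chain the eigenvalue `1` is simple.) -/
def eigenvalueGap {X : Type*} [Fintype X] [DecidableEq X] (P : Matrix X X ℝ) : ℝ :=
  1 - sSup {r : ℝ | ∃ z : ℂ,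
    Module.End.HasEigenvalue (Matrix.toLin' (P.map (algebraMap ℝ ℂ))) z ∧ z ≠ 1 ∧ r = ‖z‖}

/-! ## The quantum walk on `ℂ^(X × X)` -/

/-- The vectors `|x⟩|p_x⟩` that span the space `𝒜`. -/
def vecA {X : Type*} [DecidableEq X] (P : Matrix X X ℝ) (x : X) : X × X → ℂ :=
  fun p => if p.1 = x then ((Real.sqrt (P x p.2) : ℝ) : ℂ) else 0

/-- The vectors `|p*_y⟩|y⟩` that span the space `ℬ`. -/
def vecB {X : Type*} [DecidableEq X] (P : Matrix X X ℝ) (π : X → ℝ) (y : X) : X × X → ℂ :=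
  fun p => if p.2 = y then ((Real.sqrt (timeReversal P π y p.1) : ℝ) : ℂ) else 0

def spaceA {X : Type*} [DecidableEq X] (P : Matrix X X ℝ) : Submodule ℂ (X × X → ℂ) :=
  Submodule.span ℂ (Set.range (vecA P))

def spaceB {X : Type*} [DecidableEq X] (P : Matrix X X ℝ) (π : X → ℝ) :
    Submodule ℂ (X × X → ℂ) :=
  Submodule.span ℂ (Set.range (vecB P π))

/-- The reflection `2 ∑ i, |v i⟩⟨v i| - Id` through the span of an orthonormal family `v`. -/
def reflectionThrough {ι n : Type*} [Fintype ι] [DecidableEq n] (v : ι → n → ℂ) :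
    Matrix n n ℂ :=
  (2 : ℂ) • (∑ i, Matrix.vecMulVec (v i) (star (v i))) - 1

/-- The quantum walk `W(P) = ref(ℬ) ref(𝒜)`. -/
def walk {X : Type*} [Fintype X] [DecidableEq X] (P : Matrix X X ℝ) (π : X → ℝ) :
    Matrix (X × X) (X × X) ℂ :=
  reflectionThrough (vecB P π) * reflectionThrough (vecA P)

/-- The state `|π⟩ = ∑ x, √(π x) |x⟩|p_x⟩`. -/
def piState {X : Type*} [Fintype X] [DecidableEq X] (P : Matrix X X ℝ) (π : X → ℝ) :
    X × X → ℂ :=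
  ∑ x, ((Real.sqrt (π x) : ℝ) : ℂ) • vecA P x

/-- The discriminant matrix `D(P) = (√(p_xy p*_yx))`. -/
def discriminant {X : Type*} (P : Matrix X X ℝ) (π : X → ℝ) : Matrix X X ℝ :=
  Matrix.of fun x y => Real.sqrt (P x y * timeReversal P π y x)

/-- The phase gap `Δ(P) = 2 θ`, with `θ` the smallest angle in `(0, π/2]` whose cosine is a singular
value of `D(P)`. -/
def phaseGap {X : Type*} [Fintype X] [DecidableEq X] (P : Matrix X X ℝ) (π : X → ℝ) : ℝ :=
  2 * sInf {θ : ℝ | 0 < θ ∧ θ ≤ Real.pi / 2 ∧ ∃ i < Fintype.card X,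
    (Matrix.toEuclideanLin (discriminant P π)).singularValues i = Real.cos θ}

/-! ## Circuits

The registers are two vertex registers and qubits indexed by `A`; basis states are
`((x, y), a)` with `x y : X` and `a : A → Bool`. -/

/-- Elementary gates. `updA` is the update `|x⟩|0̄⟩ ↦ |x⟩|p_x⟩`, `updB` the update
`|0̄⟩|y⟩ ↦ |p*_y⟩|y⟩`, `updAInv` and `updBInv` are their inverses, `check` flips the phase of
the basis states whose first vertex is marked, `ctrlRefA q` and `ctrlRefB q` are the reflections
`ref(ℂ^X ⊗ |0̄⟩)` and `ref(|0̄⟩ ⊗ ℂ^X)` controlled by the qubit `q`, `hadamard q` is a Hadamard gate,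
and `zeroRef` is the reflection of the qubit register through `|0 ⋯ 0⟩`. -/
inductive Gate (A : Type*) where
  | updA | updAInv | updB | updBInv | check
  | ctrlRefA (q : A) | ctrlRefB (q : A) | hadamard (q : A) | zeroRef

/-- The inverse gate. -/
def Gate.inv {A : Type*} : Gate A → Gate A
  | .updA => .updAInv
  | .updAInv => .updA
  | .updB => .updBInv
  | .updBInv => .updB
  | g => g

/-- The unitary update `|x⟩|0̄⟩ ↦ |x⟩|p_x⟩`, with `o` in the role of `0̄`; its values on the
other basis vectors are arbitrary. -/
def IsUpdateA {X : Type*} [Fintype X] [DecidableEq X] (P : Matrix X X ℝ) (o : X)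
    (V : Matrix (X × X) (X × X) ℂ) : Prop :=
  V ∈ Matrix.unitaryGroup (X × X) ℂ ∧ ∀ x, V *ᵥ Pi.single (x, o) 1 = vecA P x

/-- The unitary update `|0̄⟩|y⟩ ↦ |p*_y⟩|y⟩`; its values on the other basis vectors are arbitrary. -/
def IsUpdateB {X : Type*} [Fintype X] [DecidableEq X] (P : Matrix X X ℝ) (π : X → ℝ) (o : X)
    (V : Matrix (X × X) (X × X) ℂ) : Prop :=
  V ∈ Matrix.unitaryGroup (X × X) ℂ ∧ ∀ y, V *ᵥ Pi.single (o, y) 1 = vecB P π y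

/-- The unitary matrix of a gate, for given update operations `V₁`, `V₂`, vertex `o = 0̄` and
marked set `M`. -/
def Gate.op {X A : Type*} [Fintype X] [DecidableEq X] [Fintype A] [DecidableEq A]
    (V₁ V₂ : Matrix (X × X) (X × X) ℂ) (o : X) (M : Finset X) :
    Gate A → Matrix ((X × X) × (A → Bool)) ((X × X) × (A → Bool)) ℂ
  | .updA => V₁ ⊗ₖ (1 : Matrix (A → Bool) (A → Bool) ℂ)
  | .updAInv => V₁ᴴ ⊗ₖ (1 : Matrix (A → Bool) (A → Bool) ℂ)
  | .updB => V₂ ⊗ₖ (1 : Matrix (A → Bool) (A → Bool) ℂ)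
  | .updBInv => V₂ᴴ ⊗ₖ (1 : Matrix (A → Bool) (A → Bool) ℂ)
  | .check => Matrix.diagonal fun b => if b.1.1 ∈ M then -1 else 1
  | .ctrlRefA q => Matrix.diagonal fun b => if b.2 q = true ∧ b.1.2 ≠ o then -1 else 1
  | .ctrlRefB q => Matrix.diagonal fun b => if b.2 q = true ∧ b.1.1 ≠ o then -1 else 1
  | .hadamard q => Matrix.of fun b b' =>
      if b.1 = b'.1 ∧ ∀ r, r ≠ q → b.2 r = b'.2 r then
        (if b.2 q = true ∧ b'.2 q = true then -1 else 1) / ((Real.sqrt 2 : ℝ) : ℂ)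
      else 0
  | .zeroRef => Matrix.diagonal fun b => if b.2 = fun _ => false then 1 else -1

/-- The unitary matrix of a circuit; the head of the list is applied first. -/
def circuitOp {X A : Type*} [Fintype X] [DecidableEq X] [Fintype A] [DecidableEq A]
    (V₁ V₂ : Matrix (X × X) (X × X) ℂ) (o : X) (M : Finset X) :
    List (Gate A) → Matrix ((X × X) × (A → Bool)) ((X × X) × (A → Bool)) ℂ
  | [] => 1
  | g :: c => circuitOp V₁ V₂ o M c * g.op V₁ V₂ o M

/-- The inverse circuit. -/
def circuitInv {A : Type*} (c : List (Gate A)) : List (Gate A) :=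
  c.reverse.map Gate.inv

/-- The operator `W` controlled by the qubit `q`. -/
def controlled {X A : Type*} [DecidableEq X] [Fintype A] [DecidableEq A] (q : A)
    (W : Matrix (X × X) (X × X) ℂ) :
    Matrix ((X × X) × (A → Bool)) ((X × X) × (A → Bool)) ℂ :=
  Matrix.of fun b b' =>
    if b.2 = b'.2 then
      (if b.2 q = true then W b.1 b'.1 else (1 : Matrix (X × X) (X × X) ℂ) b.1 b'.1)
    else 0

/-- The controlled quantum walk: undo `updA`, reflect, redo it, and the same with `updB`. -/
def ctrlWalk {A : Type*} (q : A) : List (Gate A) :=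
  [.updAInv, .ctrlRefA q, .updA, .updBInv, .ctrlRefB q, .updB]

/-- Hadamard gates on all the qubits `(i, j)`, where `i < k` and `j < s`. -/
def hadamards (k s : ℕ) : List (Gate (Fin k × Fin s)) :=
  (List.finRange k).flatMap fun i => (List.finRange s).map fun j => .hadamard (i, j)

/-- The walk to the power `2 ^ j`, controlled by the qubit `(i, j)`, for all `i < k`, `j < s`. -/
def ctrlPowers (k s : ℕ) : List (Gate (Fin k × Fin s)) :=
  (List.finRange k).flatMap fun (i : Fin k) => (List.finRange s).flatMap fun (j : Fin s) =>
    (List.replicate (2 ^ j.val) (ctrlWalk (i, j))).flatten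

/-- `k` runs of phase estimation of the quantum walk with `s` bits of precision each. Only the test
whether the outcome is zero is used below, and for it Hadamard gates may take the place of the
final inverse Fourier transform, as both of them send the uniform superposition to `|0 ⋯ 0⟩`. -/
def phaseEstimation (k s : ℕ) : List (Gate (Fin k × Fin s)) :=
  hadamards k s ++ ctrlPowers k s ++ hadamards k s

/-- The approximate reflection: estimate the phase `k` times, flip the sign unless all estimates
are zero, and undo the phase estimation. -/
def approxReflection (k s : ℕ) : List (Gate (Fin k × Fin s)) :=
  phaseEstimation k s ++ [.zeroRef] ++ circuitInv (phaseEstimation k s)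

/-- The number of bits that phase estimation uses for the phase gap `Δ`. -/
def phaseBits (Δ : ℝ) : ℕ := ⌈Real.logb 2 (4 * Real.pi / Δ)⌉₊

/-! ## The search procedure -/

/-- `ψ ⊗ |0 ⋯ 0⟩`. -/
def withZeros {X : Type*} (A : Type*) [Fintype A] [DecidableEq A] (ψ : X × X → ℂ) :
    (X × X) × (A → Bool) → ℂ :=
  fun b => if b.2 = fun _ => false then ψ b.1 else 0

/-- The state `∑ x, √(π x) |x⟩|0̄⟩` that the setup constructs. -/
def setupState {X : Type*} [DecidableEq X] (π : X → ℝ) (o : X) : X × X → ℂ :=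
  fun p => if p.2 = o then ((Real.sqrt (π p.1) : ℝ) : ℂ) else 0

/-- One iteration: the phase flip of the marked vertices, then the approximate reflection. -/
def searchStep (k s : ℕ) : List (Gate (Fin k × Fin s)) :=
  .check :: approxReflection k s

/-- The circuit of Quantum Search that follows the setup: one update, which turns the setup state
into `|π⟩`, and `t` iterations. -/
def searchCircuit (k s t : ℕ) : List (Gate (Fin k × Fin s)) :=
  .updA :: (List.replicate t (searchStep k s)).flatten

/-- The final state of Quantum Search. -/
def searchState {X : Type*} [Fintype X] [DecidableEq X] (π : X → ℝ)
    (V₁ V₂ : Matrix (X × X) (X × X) ℂ) (o : X) (M : Finset X) (k s t : ℕ) :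
    (X × X) × (Fin k × Fin s → Bool) → ℂ :=
  circuitOp V₁ V₂ o M (searchCircuit k s t) *ᵥ withZeros (Fin k × Fin s) (setupState π o)

/-- The probability that the first register of the final state is observed in `M`. -/
def successProb {X : Type*} [Fintype X] [DecidableEq X] (π : X → ℝ)
    (V₁ V₂ : Matrix (X × X) (X × X) ℂ) (o : X) (M : Finset X) (k s t : ℕ) : ℝ :=
  ∑ b : (X × X) × (Fin k × Fin s → Bool),
    if b.1.1 ∈ M then ‖searchState π V₁ V₂ o M k s t b‖ ^ 2 else 0

/-- One measure of complexity: the costs of the setup, of an update, of a check, and of an operation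
that does not involve the data (`1` if such operations are charged at unit cost,
`0` if only queries are counted). -/
structure Costs where
  setup : ℝ
  update : ℝ
  checking : ℝ
  elementary : ℝ
  setup_nonneg : 0 ≤ setup
  checking_nonneg : 0 ≤ checking
  elementary_nonneg : 0 ≤ elementary
  elementary_le_update : elementary ≤ update

def Gate.cost {A : Type*} (κ : Costs) : Gate A → ℝ
  | .updA => κ.update
  | .updAInv => κ.update
  | .updB => κ.update
  | .updBInv => κ.update
  | .check => κ.checking
  | .ctrlRefA _ => κ.elementary
  | .ctrlRefB _ => κ.elementary
  | .hadamard _ => κ.elementary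
  | .zeroRef => κ.elementary

def circuitCost {A : Type*} (κ : Costs) (c : List (Gate A)) : ℝ :=
  (c.map (Gate.cost κ)).sum

/-- The cost of Quantum Search: the setup, the circuit, and the check of the observed vertex. -/
def searchCost (κ : Costs) (k s t : ℕ) : ℝ :=
  κ.setup + circuitCost κ (searchCircuit k s t) + κ.checking

end

end QuantumWalk

open QuantumWalk

namespace QuantumWalk

/-! ## Ergodic reversible chains -/

/-! The search is Grover's iteration in the plane spanned by the marked and the unmarked part of
`|π⟩`. The check is an exact reflection of this plane; the reflection through `|π⟩` is replaced by
`R(P)`, and everything rests on how well `R(P)` imitates it.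

By reversibility the discriminant `D` is similar to `P` through `diag √π`, so its singular values
are the moduli of eigenvalues of `P`. Ergodicity leaves only `√π` for the singular value 1; the
others are at most `1 - δ`, and `1 - θ²/2 ≤ cos θ ≤ 1 - δ` forces `θ ≥ √δ` (`phaseGap_spec`). This
is the quadratic gain in `δ`.

No spectral decomposition of the walk `W` is needed. `D` is the Gram matrix between the two
orthonormal families spanning `𝒜` and `ℬ`, and the bound `1 - D² ≥ sin² θ` on the complement of `√π`
carries over to `‖φ - Wφ‖ ≥ 2 sin θ ‖φ‖` on `busySpace`, the part of `𝒜 + ℬ` orthogonal to `|π⟩`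
(`gap_le_norm_sq_projection_sub`, `le_norm_sub_walk`). With Hadamard gates instead of the Fourier
transform, the branch of `k` phase estimations in which all outcomes are zero carries `K(W)^k ψ`,
where `K` is the average of the powers `Wᵐ`, `m < 2ˢ` (`phaseEstimation_apply_zero`). Writing `φ = χ
- Wχ` telescopes the average, so `K(W)` shrinks `busySpace` by the factor 1/4
(`norm_phaseKernel_mulVec_le`). If `U` is the phase estimation and `Π₀` the projection onto zero
ancillas, then `R + 1 = 2 U† Π₀ U` on clean ancillas, so the error is exactly `2 ‖K(W)^k ψ‖`, at
most `2 · 4⁻ᵏ ‖ψ‖ ≤ 2⁻ᵏ ‖ψ‖`.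

An ideal iteration advances the Grover angle by `2 arcsin √ε`. By unitarity the errors of `t`
iterations only add up, to `t 2⁻ᵏ` (`exists_amp_near_searchState`), so a `k` logarithmic in `1/√ε`
suffices. One `R(P)` costs of the order of `k 2ˢ` updates, and `2ˢ ≤ 16/√δ`. -/

theorem eq_of_weighted_sum_eq {ι : Type*} [Fintype ι] {p : ι → ℝ} (hp : ∀ i, 0 ≤ p i)
    (hs : ∑ i, p i = 1) {f : ι → ℂ} {c : ℂ} (hf : ∀ i, ‖f i‖ ≤ ‖c‖)
    (h : ∑ i, (p i : ℂ) * f i = c) {i : ι} (hi : 0 < p i) : f i = c := by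
  -- The right-hand side is real-affine in `f j` and has weighted average zero, so its nonnegative
  -- terms of positive weight all vanish: the equality case of the triangle inequality.
  have key : ∀ j, ‖f j - c‖ ^ 2 ≤ 2 * (‖c‖ ^ 2 - (f j * star c).re) := by
    intro j
    have h1 := hf j
    have h2 : ‖f j‖ ^ 2 ≤ ‖c‖ ^ 2 := by gcongr
    rw [← Complex.normSq_eq_norm_sq, ← Complex.normSq_eq_norm_sq] at h2
    rw [← Complex.normSq_eq_norm_sq, ← Complex.normSq_eq_norm_sq, Complex.normSq_sub]
    simp only [Complex.star_def]
    linarith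
  have hsum : ∑ j, p j * (‖c‖ ^ 2 - (f j * star c).re) = 0 := by
    have h3 : ∑ j, p j * (f j * star c).re = ‖c‖ ^ 2 := by
      have h4 : (∑ j, ((p j : ℂ) * f j) * star c).re = (c * star c).re := by
        rw [← Finset.sum_mul, h]
      rw [Complex.re_sum] at h4
      simp only [Complex.star_def, Complex.mul_conj, Complex.ofReal_re] at h4
      rw [← Complex.normSq_eq_norm_sq, ← h4]
      refine Finset.sum_congr rfl fun j _ => ?_
      rw [mul_assoc, Complex.re_ofReal_mul]
      rfl
    simp only [mul_sub, Finset.sum_sub_distrib, h3, ← Finset.sum_mul, hs]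
    ring
  have hnn : ∀ j, 0 ≤ ‖c‖ ^ 2 - (f j * star c).re := fun j => by
    nlinarith [key j, sq_nonneg ‖f j - c‖]
  have h0 := (Finset.sum_eq_zero_iff_of_nonneg fun j _ => mul_nonneg (hp j) (hnn j)).1 hsum i
    (Finset.mem_univ i)
  have h1 : ‖c‖ ^ 2 - (f i * star c).re = 0 := by
    rcases mul_eq_zero.1 h0 with h | h
    · exact absurd h hi.ne'
    · exact h
  have h2 := key i
  rw [h1, mul_zero] at h2
  have h3 : ‖f i - c‖ = 0 := by nlinarith [norm_nonneg (f i - c)]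
  exact sub_eq_zero.1 (norm_eq_zero.1 h3)

section Chain

variable {X : Type*} [Fintype X] [DecidableEq X] {P : Matrix X X ℝ} {π : X → ℝ}

omit [DecidableEq X] in
theorem exists_norm_max [Nonempty X] (f : X → ℂ) : ∃ x, ∀ y, ‖f y‖ ≤ ‖f x‖ := by
  obtain ⟨x, hx⟩ := Finite.exists_max fun x => ‖f x‖
  exact ⟨x, hx⟩

theorem map_mulVec_pow {f : X → ℂ} {z : ℂ} (h : P.map (algebraMap ℝ ℂ) *ᵥ f = z • f) (n : ℕ) :
    (P ^ n).map (algebraMap ℝ ℂ) *ᵥ f = z ^ n • f := by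
  have hm : ∀ n, (P ^ n).map (algebraMap ℝ ℂ) = (P.map (algebraMap ℝ ℂ)) ^ n := fun n =>
    map_pow (algebraMap ℝ ℂ).mapMatrix P n
  rw [hm]
  induction n with
  | zero => simp
  | succ n ih => rw [pow_succ, ← Matrix.mulVec_mulVec, h, Matrix.mulVec_smul, ih, smul_smul,
      pow_succ']

theorem norm_le_one_of_eigenvector (hP : P ∈ Matrix.rowStochastic ℝ X) {f : X → ℂ} {z : ℂ}
    (hf : f ≠ 0) (h : P.map (algebraMap ℝ ℂ) *ᵥ f = z • f) : ‖z‖ ≤ 1 := by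
  obtain ⟨y, hy⟩ := Function.ne_iff.1 hf
  have : Nonempty X := ⟨y⟩
  obtain ⟨x, hx⟩ := exists_norm_max f
  have hpos : 0 < ‖f x‖ := (norm_pos_iff.2 hy).trans_le (hx y)
  have h1 : ‖z‖ * ‖f x‖ ≤ ‖f x‖ := by
    have h2 := congrFun h x
    rw [Pi.smul_apply, smul_eq_mul] at h2
    rw [← norm_mul, ← h2, Matrix.mulVec, dotProduct]
    calc ‖∑ j, P.map (algebraMap ℝ ℂ) x j * f j‖ ≤ ∑ j, P x j * ‖f x‖ := by
          refine norm_sum_le_of_le _ fun j _ => ?_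
          have h0 := Matrix.nonneg_of_mem_rowStochastic hP (i := x) (j := j)
          rw [norm_mul, Matrix.map_apply, Complex.coe_algebraMap, Complex.norm_real,
            Real.norm_of_nonneg h0]
          exact mul_le_mul_of_nonneg_left (hx j) h0
      _ = ‖f x‖ := by rw [← Finset.sum_mul, Matrix.sum_row_of_mem_rowStochastic hP, one_mul]
  exact le_of_mul_le_mul_right (by linarith) hpos

/-- Maximum principle: `z ^ n * f x` is an average of values of `f`, none of larger modulus, so
every value of positive weight equals it. -/
theorem eigenvector_apply_eq (hP : P ∈ Matrix.rowStochastic ℝ X) {f : X → ℂ} {z : ℂ}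
    (hz : ‖z‖ = 1) (h : P.map (algebraMap ℝ ℂ) *ᵥ f = z • f) {x : X}
    (hx : ∀ y, ‖f y‖ ≤ ‖f x‖) {n : ℕ} {y : X} (hn : 0 < (P ^ n) x y) : f y = z ^ n * f x := by
  have hPn : P ^ n ∈ Matrix.rowStochastic ℝ X := pow_mem hP n
  refine eq_of_weighted_sum_eq (p := (P ^ n) x)
    (fun j => Matrix.nonneg_of_mem_rowStochastic hPn)
    (Matrix.sum_row_of_mem_rowStochastic hPn x) (f := f) ?_ ?_ hn
  · intro j; rw [norm_mul, norm_pow, hz, one_pow, one_mul]; exact hx j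
  · exact congrFun (map_mulVec_pow h n) x

/-- At a point where `|f|` is maximal, each return time `n` satisfies `z ^ n = 1`. Hence `orderOf z`
divides all return times and is 1 by aperiodicity; infinite order (`orderOf z = 0`) is covered too.
-/
theorem IsErgodicChain.eigenvalue_eq_one (hP : IsErgodicChain P) {f : X → ℂ} {z : ℂ}
    (hf : f ≠ 0) (h : P.map (algebraMap ℝ ℂ) *ᵥ f = z • f) (hz : ‖z‖ = 1) : z = 1 := by
  obtain ⟨y, hy⟩ := Function.ne_iff.1 hf
  have : Nonempty X := ⟨y⟩
  obtain ⟨x, hx⟩ := exists_norm_max f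
  have hpos : 0 < ‖f x‖ := (norm_pos_iff.2 hy).trans_le (hx y)
  refine orderOf_eq_one_iff.1 (hP.aperiodic x (orderOf z) fun n _ hn => ?_)
  refine orderOf_dvd_of_pow_eq_one ?_
  have h1 := eigenvector_apply_eq hP.stochastic hz h hx hn
  exact mul_right_cancel₀ (norm_pos_iff.1 hpos) (by rw [← h1, one_mul])

theorem IsErgodicChain.exists_pow_pos (hP : IsErgodicChain P) (x y : X) :
    ∃ n, 0 < (P ^ n) x y := by
  obtain ⟨n, -, hn⟩ := (Matrix.isIrreducible_iff_exists_pow_pos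
    fun _ _ => Matrix.nonneg_of_mem_rowStochastic hP.stochastic).1 hP.irreducible x y
  exact ⟨n, hn⟩

omit [DecidableEq X] in
theorem map_mulVec_ofReal (P : Matrix X X ℝ) (f : X → ℝ) :
    P.map (algebraMap ℝ ℂ) *ᵥ (fun x => (f x : ℂ)) = fun x => ((P *ᵥ f) x : ℂ) := by
  ext x; simp [Matrix.mulVec, dotProduct]

theorem IsErgodicChain.harmonic_const (hP : IsErgodicChain P) {f : X → ℝ} (h : P *ᵥ f = f)
    (x y : X) : f x = f y := by
  have hf : P.map (algebraMap ℝ ℂ) *ᵥ (fun x => (f x : ℂ)) = (1 : ℂ) • fun x => (f x : ℂ) := by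
    rw [map_mulVec_ofReal, h, one_smul]
  have : Nonempty X := ⟨x⟩
  obtain ⟨x₀, hx₀⟩ := exists_norm_max fun x => (f x : ℂ)
  have key : ∀ y, f y = f x₀ := fun y => by
    obtain ⟨n, hn⟩ := hP.exists_pow_pos x₀ y
    have := eigenvector_apply_eq hP.stochastic (by simp) hf hx₀ hn
    simpa using this
  rw [key, key y]

theorem IsErgodicChain.eq_zero_of_mulVec_eq_neg (hP : IsErgodicChain P) {f : X → ℝ}
    (h : P *ᵥ f = -f) : f = 0 := by
  by_contra hf
  have h1 := hP.eigenvalue_eq_one (f := fun x => (f x : ℂ)) (z := -1) (fun h0 => hf <| by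
    ext x; simpa using congrFun h0 x) (by rw [map_mulVec_ofReal, h]; ext x; simp) (by simp)
  norm_num at h1

theorem IsErgodicChain.stationary_pos (hP : IsErgodicChain P) (hπ : IsStationaryDist P π) (x : X) :
    0 < π x := by
  have hinv : ∀ n, π ᵥ* P ^ n = π := fun n => by
    induction n with
    | zero => simp
    | succ n ih => rw [pow_succ, ← Matrix.vecMul_vecMul, ih, hπ.invariant]
  obtain ⟨y, -, hy⟩ : ∃ y ∈ Finset.univ, 0 < π y :=
    Finset.exists_lt_of_sum_lt (f := fun _ => (0 : ℝ)) (by simp [hπ.sum_eq_one])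
  obtain ⟨n, hn⟩ := hP.exists_pow_pos y x
  rw [← hinv n, Matrix.vecMul, dotProduct]
  refine (mul_pos hy hn).trans_le (Finset.single_le_sum (f := fun i => π i * (P ^ n) i x)
    (fun i _ => mul_nonneg (hπ.nonneg i) ?_) (Finset.mem_univ y))
  exact Matrix.nonneg_of_mem_rowStochastic (pow_mem hP.stochastic n)

/-! ## The eigenvalue gap -/

theorem bddAbove_norm_eigenvalue (hP : IsErgodicChain P) :
    (1 : ℝ) ∈ upperBounds {r : ℝ | ∃ z : ℂ,
    Module.End.HasEigenvalue (Matrix.toLin' (P.map (algebraMap ℝ ℂ))) z ∧ z ≠ 1 ∧ r = ‖z‖} := by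
  rintro r ⟨z, hz, -, rfl⟩
  obtain ⟨f, hf⟩ := hz.exists_hasEigenvector
  exact norm_le_one_of_eigenvector hP.stochastic hf.2
    (by simpa [Matrix.toLin'_apply] using hf.apply_eq_smul)

theorem eigenvalueGap_le_one (P : Matrix X X ℝ) : eigenvalueGap P ≤ 1 := by
  have : 0 ≤ sSup {r : ℝ | ∃ z : ℂ,
    Module.End.HasEigenvalue (Matrix.toLin' (P.map (algebraMap ℝ ℂ))) z ∧ z ≠ 1 ∧ r = ‖z‖} :=
    Real.sSup_nonneg (by rintro r ⟨z, -, -, rfl⟩; exact norm_nonneg z)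
  unfold eigenvalueGap
  linarith

theorem IsErgodicChain.eigenvalueGap_pos (hP : IsErgodicChain P) : 0 < eigenvalueGap P := by
  unfold eigenvalueGap
  set S := {r : ℝ | ∃ z : ℂ,
    Module.End.HasEigenvalue (Matrix.toLin' (P.map (algebraMap ℝ ℂ))) z ∧ z ≠ 1 ∧ r = ‖z‖} with hS
  rcases S.eq_empty_or_nonempty with h | h
  -- Without an eigenvalue other than 1 the supremum defaults to 0, and the gap is 1.
  · rw [h, Real.sSup_empty]; norm_num
  -- Finitely many eigenvalues: the supremum is attained, so strict inequality for each of them is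
  -- enough.
  · have hfin : S.Finite := by
      have h1 : {z : ℂ | Module.End.HasEigenvalue
        (Matrix.toLin' (P.map (algebraMap ℝ ℂ))) z}.Finite := Module.End.finite_hasEigenvalue _
      refine (h1.image norm).subset ?_
      rintro r ⟨z, hz, -, rfl⟩
      exact ⟨z, hz, rfl⟩
    obtain ⟨z, hz, hz1, hr⟩ := h.csSup_mem hfin
    have hle := bddAbove_norm_eigenvalue hP ⟨z, hz, hz1, rfl⟩
    have hne : ‖z‖ ≠ 1 := fun h1 => by
      obtain ⟨f, hf⟩ := hz.exists_hasEigenvector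
      exact hz1 (hP.eigenvalue_eq_one hf.2
        (by simpa [Matrix.toLin'_apply] using hf.apply_eq_smul) h1)
    rw [hr]
    linarith [lt_of_le_of_ne hle hne]

theorem norm_le_one_sub_eigenvalueGap (hP : IsErgodicChain P) {f : X → ℝ} {a : ℝ} (hf : f ≠ 0)
    (h : P *ᵥ f = a • f) (ha : a ≠ 1) : |a| ≤ 1 - eigenvalueGap P := by
  unfold eigenvalueGap
  rw [sub_sub_cancel]
  refine le_csSup ⟨1, bddAbove_norm_eigenvalue hP⟩ ⟨(a : ℂ), ?_, by simpa using ha, by simp⟩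
  refine Module.End.hasEigenvalue_of_hasEigenvector (x := fun x => (f x : ℂ))
    ⟨Module.End.mem_eigenspace_iff.2 ?_, fun h0 => hf ?_⟩
  · rw [Matrix.toLin'_apply, map_mulVec_ofReal, h]; ext x; simp
  · ext x; simpa using congrFun h0 x

end Chain
/-! ## The discriminant of a reversible chain -/

section Discriminant

variable {X : Type*} [Fintype X] [DecidableEq X] {P : Matrix X X ℝ} {π : X → ℝ}

omit [Fintype X] [DecidableEq X] in
theorem discriminant_isSymm (hr : IsReversibleChain P π) :
    (discriminant P π)ᵀ = discriminant P π := by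
  ext x y
  rw [Matrix.transpose_apply, discriminant, Matrix.of_apply, Matrix.of_apply,
    show timeReversal P π = P from hr, mul_comm]

theorem detailed_balance (hP : IsErgodicChain P) (hπ : IsStationaryDist P π)
    (hr : IsReversibleChain P π) (x y : X) : π x * P x y = π y * P y x := by
  have h : π x * P x y / π y = P y x := congrFun (congrFun hr y) x
  rw [← h, mul_div_cancel₀ _ (hP.stationary_pos hπ y).ne']

/-- The similarity `D diag(√π) = diag(√π) P` in entries. By detailed balance the product under the
root is the perfect square `π x * P x y ^ 2`, up to the factor `π x`. -/
theorem sqrt_mul_discriminant (hP : IsErgodicChain P) (hπ : IsStationaryDist P π)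
    (hr : IsReversibleChain P π) (x y : X) :
    discriminant P π x y * √(π y) = √(π x) * P x y := by
  have h0 := Matrix.nonneg_of_mem_rowStochastic hP.stochastic (i := x) (j := y)
  have hx := hP.stationary_pos hπ x
  rw [discriminant, Matrix.of_apply, show timeReversal P π = P from hr,
    ← Real.sqrt_mul (mul_nonneg h0 (Matrix.nonneg_of_mem_rowStochastic hP.stochastic)),
    show P x y * P y x * π y = π x * P x y ^ 2 by
      linear_combination (-P x y) * detailed_balance hP hπ hr x y,
    Real.sqrt_mul hx.le, Real.sqrt_sq h0]

theorem mulVec_div_sqrt (hP : IsErgodicChain P) (hπ : IsStationaryDist P π)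
    (hr : IsReversibleChain P π) (e : X → ℝ) :
    (P *ᵥ fun x => e x / √(π x)) = fun x => (discriminant P π *ᵥ e) x / √(π x) := by
  ext x
  have hx := Real.sqrt_pos.2 (hP.stationary_pos hπ x)
  simp only [Matrix.mulVec, dotProduct]
  rw [eq_div_iff hx.ne', Finset.sum_mul]
  refine Finset.sum_congr rfl fun y _ => ?_
  have hy := Real.sqrt_pos.2 (hP.stationary_pos hπ y)
  have h := sqrt_mul_discriminant hP hπ hr x y
  field_simp
  linear_combination (-e y) * h

theorem div_sqrt_ne_zero (hP : IsErgodicChain P) (hπ : IsStationaryDist P π) {e : X → ℝ}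
    (he : e ≠ 0) : (fun x => e x / √(π x)) ≠ 0 := fun h => he <| by
  ext x
  have hx := Real.sqrt_pos.2 (hP.stationary_pos hπ x)
  have := congrFun h x
  simpa [hx.ne'] using this

theorem mulVec_div_sqrt_of_eigenvector (hP : IsErgodicChain P) (hπ : IsStationaryDist P π)
    (hr : IsReversibleChain P π) {e : X → ℝ} {a : ℝ} (h : discriminant P π *ᵥ e = a • e) :
    (P *ᵥ fun x => e x / √(π x)) = a • fun x => e x / √(π x) := by
  rw [mulVec_div_sqrt hP hπ hr, h]
  ext x
  simp [mul_div_assoc]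

/-- If `D² e = σ² e`, then `± σ` is an eigenvalue of the chain. -/
theorem le_one_sub_gap_of_sq (hP : IsErgodicChain P) (hπ : IsStationaryDist P π)
    (hr : IsReversibleChain P π) {e : X → ℝ} (he : e ≠ 0) {σ : ℝ} (h0 : 0 ≤ σ) (h1 : σ ≠ 1)
    (h : discriminant P π *ᵥ (discriminant P π *ᵥ e) = σ ^ 2 • e) : σ ≤ 1 - eigenvalueGap P := by
  -- Factor `D² - σ² = (D - σ)(D + σ)`: either `e` is an eigenvector for `-σ`, or `(D + σ) e` is one
  -- for `σ`.
  by_cases hg : discriminant P π *ᵥ e + σ • e = 0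
  · have h2 : discriminant P π *ᵥ e = (-σ) • e := by
      rw [neg_smul]; exact eq_neg_of_add_eq_zero_left hg
    have := norm_le_one_sub_eigenvalueGap hP (div_sqrt_ne_zero hP hπ he)
      (mulVec_div_sqrt_of_eigenvector hP hπ hr h2) (by linarith)
    rwa [abs_neg, abs_of_nonneg h0] at this
  · have h2 : discriminant P π *ᵥ (discriminant P π *ᵥ e + σ • e) =
        σ • (discriminant P π *ᵥ e + σ • e) := by
      rw [Matrix.mulVec_add, Matrix.mulVec_smul, h, smul_add, smul_smul, sq, add_comm]
    have := norm_le_one_sub_eigenvalueGap hP (div_sqrt_ne_zero hP hπ hg)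
      (mulVec_div_sqrt_of_eigenvector hP hπ hr h2) h1
    rwa [abs_of_nonneg h0] at this

/-- If `De ≠ e`, then `De - e` would be an eigenvector for `-1`, which aperiodicity excludes. So `De
= e`, and `e / √π` is harmonic, hence constant. -/
theorem exists_eq_smul_sqrt (hP : IsErgodicChain P) (hπ : IsStationaryDist P π)
    (hr : IsReversibleChain P π) {e : X → ℝ}
    (h : discriminant P π *ᵥ (discriminant P π *ᵥ e) = e) : ∃ a : ℝ, ∀ x, e x = a * √(π x) := by
  have hfix : discriminant P π *ᵥ e = e := by
    by_contra hne
    have h2 : discriminant P π *ᵥ (discriminant P π *ᵥ e - e) =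
        (-1 : ℝ) • (discriminant P π *ᵥ e - e) := by
      rw [Matrix.mulVec_sub, h, neg_one_smul, neg_sub]
    refine div_sqrt_ne_zero hP hπ (sub_ne_zero.2 hne) (hP.eq_zero_of_mulVec_eq_neg ?_)
    rw [mulVec_div_sqrt_of_eigenvector hP hπ hr h2, neg_one_smul]
  have h3 := hP.harmonic_const (f := fun x => e x / √(π x)) (by
    rw [mulVec_div_sqrt hP hπ hr, hfix])
  rcases isEmpty_or_nonempty X with hX | ⟨⟨x₀⟩⟩
  · exact ⟨0, fun x => (hX.false x).elim⟩
  · refine ⟨e x₀ / √(π x₀), fun x => ?_⟩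
    rw [h3 x₀ x, div_mul_cancel₀ _ (Real.sqrt_pos.2 (hP.stationary_pos hπ x)).ne']

/-- An eigenbasis of `D²`, with the singular values of `D`. -/
theorem exists_singular_basis (hr : IsReversibleChain P π) :
    ∃ b : OrthonormalBasis (Fin (Fintype.card X)) ℝ (EuclideanSpace ℝ X), ∀ i,
      discriminant P π *ᵥ (discriminant P π *ᵥ (b i).ofLp) =
        (Matrix.toEuclideanLin (discriminant P π)).singularValues i ^ 2 • (b i).ofLp := by
  set T := Matrix.toEuclideanLin (discriminant P π) with hT
  have hn : Module.finrank ℝ (EuclideanSpace ℝ X) = Fintype.card X := finrank_euclideanSpace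
  -- Squared singular values are eigenvalues of `T† T`, which by symmetry is `D²`.
  have hadj : T.adjoint = T := by
    rw [hT, ← Matrix.toEuclideanLin_conjTranspose_eq_adjoint]
    congr 1
    rw [Matrix.conjTranspose_eq_transpose_of_trivial, discriminant_isSymm hr]
  refine ⟨T.isSymmetric_adjoint_comp_self.eigenvectorBasis hn, fun i => ?_⟩
  have h := T.isSymmetric_adjoint_comp_self.apply_eigenvectorBasis hn i
  rw [← T.sq_singularValues_fin hn i, LinearMap.comp_apply] at h
  exact congrArg WithLp.ofLp ((LinearMap.congr_fun hadj _).symm.trans h)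

variable [Nontrivial X]

/-- Collects all that is used about the phase gap: the infimum is attained at an angle `θ ≥ √δ`, and
`D` contracts the complement of `√π` by `cos θ`. -/
theorem phaseGap_spec (hP : IsErgodicChain P) (hπ : IsStationaryDist P π)
    (hr : IsReversibleChain P π) :
    ∃ θ : ℝ, phaseGap P π = 2 * θ ∧ 0 < θ ∧ θ ≤ Real.pi / 2 ∧ √(eigenvalueGap P) ≤ θ ∧
      ∀ v : X → ℝ, ∑ x, √(π x) * v x = 0 →
        ∑ x, (discriminant P π *ᵥ v) x ^ 2 ≤ Real.cos θ ^ 2 * ∑ x, v x ^ 2 := by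
  obtain ⟨b, hb⟩ := exists_singular_basis hr
  set σ := (Matrix.toEuclideanLin (discriminant P π)).singularValues with hσ
  set S := {θ : ℝ | 0 < θ ∧ θ ≤ Real.pi / 2 ∧ ∃ i < Fintype.card X, σ i = Real.cos θ} with hS
  have hσ0 : ∀ i, 0 ≤ σ i := fun i => LinearMap.singularValues_nonneg _ i
  have hb0 : ∀ i, (b i).ofLp ≠ 0 := fun i h => b.toBasis.ne_zero i (by
    rw [b.coe_toBasis]; exact (WithLp.ofLp_injective 2) h)
  have hgap : ∀ i : Fin (Fintype.card X), σ i ≠ 1 → σ i ≤ 1 - eigenvalueGap P := fun i hi =>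
    le_one_sub_gap_of_sq hP hπ hr (hb0 i) (hσ0 i) hi (hb i)
  have hδ := hP.eigenvalueGap_pos
  have horth : ∀ v : X → ℝ, ∑ x, √(π x) * v x = 0 → ∀ i : Fin (Fintype.card X), σ i = 1 →
      inner ℝ (b i) (WithLp.toLp 2 v) = 0 := by
    intro v hv i hi
    obtain ⟨a, ha⟩ := exists_eq_smul_sqrt hP hπ hr (e := (b i).ofLp) (by
      rw [hb i, hi, one_pow, one_smul])
    rw [PiLp.inner_apply]
    simp only [ha, RCLike.inner_apply, conj_trivial]
    rw [show ∑ x, v x * (a * √(π x)) = a * ∑ x, √(π x) * v x by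
      rw [Finset.mul_sum]; exact Finset.sum_congr rfl fun x _ => by ring, hv, mul_zero]
  have hmem : ∀ i : Fin (Fintype.card X), σ i ≠ 1 → Real.arccos (σ i) ∈ S := fun i hi => by
    have h1 := hgap i hi
    refine ⟨Real.arccos_pos.2 (by linarith), Real.arccos_le_pi_div_two.2 (hσ0 i), i, i.2, ?_⟩
    rw [Real.cos_arccos (by linarith [hσ0 i]) (by linarith)]
  -- On an empty set `sInf` would give 0. If all singular values were 1, every basis vector would be
  -- parallel to `√π`; the vector `v` below, supported on two states, is nonzero and orthogonal to
  -- `√π`.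
  have hne : S.Nonempty := by
    by_contra hcon
    have hall : ∀ i : Fin (Fintype.card X), σ i = 1 := fun i => by
      by_contra hi; exact hcon ⟨_, hmem i hi⟩
    obtain ⟨x, y, hxy⟩ := exists_pair_ne X
    have hx := Real.sqrt_pos.2 (hP.stationary_pos hπ x)
    set v : X → ℝ := fun z => if z = x then √(π y) else if z = y then -√(π x) else 0 with hv
    have hv0 : ∑ z, √(π z) * v z = 0 := by
      rw [Fintype.sum_eq_add x y hxy (fun z hz => by simp [hv, hz.1, hz.2])]
      simp [hv, hxy.symm]; ring
    have hz : WithLp.toLp 2 v = 0 := by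
      rw [← b.sum_repr' (WithLp.toLp 2 v)]
      exact Finset.sum_eq_zero fun i _ => by rw [horth v hv0 i (hall i), zero_smul]
    have h2 : v y = 0 := by
      have := congrArg (fun w : EuclideanSpace ℝ X => w y) hz
      simpa using this
    simp only [hv, hxy.symm, if_true, if_false] at h2
    linarith
  have hbdd : BddBelow S := ⟨0, fun θ h => h.1.le⟩
  have hfin : S.Finite := by
    refine ((Set.finite_range fun i : Fin (Fintype.card X) => Real.arccos (σ i))).subset ?_
    rintro θ ⟨h0, h1, i, hi, hθ⟩
    refine ⟨⟨i, hi⟩, ?_⟩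
    simp only
    rw [hθ, Real.arccos_cos h0.le (by linarith [Real.pi_pos])]
  obtain ⟨h0, h1, i, hi, hθ⟩ := hne.csInf_mem hfin
  refine ⟨sInf S, rfl, h0, h1, ?_, ?_⟩
  · have h2 : σ i ≤ 1 - eigenvalueGap P := hgap ⟨i, hi⟩ (fun h => by
      have h3 := Real.cos_lt_cos_of_nonneg_of_le_pi_div_two le_rfl h1 h0
      rw [Real.cos_zero, ← hθ] at h3
      simp only at h
      linarith)
    -- Gives `θ² ≥ 2δ`; the factor 2 is given away.
    have h3 := Real.one_sub_sq_div_two_le_cos (x := sInf S)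
    refine Real.sqrt_le_iff.2 ⟨h0.le, ?_⟩
    rw [← hθ] at h3
    linarith [sq_nonneg (sInf S)]
  · intro v hv
    have hcos : 0 ≤ Real.cos (sInf S) := by rw [← hθ]; exact hσ0 i
    set V : EuclideanSpace ℝ X := WithLp.toLp 2 v with hV
    have hD : ∑ x, (discriminant P π *ᵥ v) x ^ 2 = ∑ x, v x * (discriminant P π *ᵥ
        (discriminant P π *ᵥ v)) x := by
      have : (discriminant P π *ᵥ v) ⬝ᵥ (discriminant P π *ᵥ v) =
          v ⬝ᵥ (discriminant P π *ᵥ (discriminant P π *ᵥ v)) := by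
        rw [Matrix.dotProduct_mulVec v, ← Matrix.mulVec_transpose, discriminant_isSymm hr]
      simpa [dotProduct, sq] using this
    have hexp : discriminant P π *ᵥ (discriminant P π *ᵥ v) =
        ∑ j : Fin (Fintype.card X), (inner ℝ (b j) V * σ j ^ 2) • (b j).ofLp := by
      have h2 : v = ∑ j, inner ℝ (b j) V • (b j).ofLp := by
        have := congrArg WithLp.ofLp (b.sum_repr' V)
        rw [WithLp.ofLp_sum] at this
        exact this.symm
      conv_lhs => rw [h2]
      simp only [Matrix.mulVec_sum, Matrix.mulVec_smul, hb, smul_smul]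
    have h3 : ∑ x, (discriminant P π *ᵥ v) x ^ 2 =
        ∑ j : Fin (Fintype.card X), σ j ^ 2 * inner ℝ (b j) V ^ 2 := by
      rw [hD, hexp]
      simp only [Finset.sum_apply, Finset.mul_sum, Pi.smul_apply, smul_eq_mul]
      rw [Finset.sum_comm]
      refine Finset.sum_congr rfl fun j _ => ?_
      have h4 : inner ℝ (b j) V = ∑ x, v x * (b j).ofLp x := by
        rw [PiLp.inner_apply]; rfl
      rw [sq (inner ℝ (b j) V)]
      nth_rw 3 [h4]
      rw [← mul_assoc, Finset.mul_sum]
      exact Finset.sum_congr rfl fun x _ => by ring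
    have h5 : ∑ x, v x ^ 2 = ∑ j, inner ℝ (b j) V ^ 2 := by
      have := b.sum_sq_norm_inner_right V
      rw [EuclideanSpace.norm_sq_eq] at this
      simpa using this.symm
    rw [h3, h5, Finset.mul_sum]
    refine Finset.sum_le_sum fun j _ => ?_
    -- Directions of singular value 1 do not occur in `v`; every other angle `arccos (σ j)` is at
    -- least the infimum.
    by_cases hj : σ j = 1
    · rw [horth v hv j hj]; simp
    · have h6 : sInf S ≤ Real.arccos (σ j) := csInf_le hbdd (hmem j hj)
      have h7 := Real.cos_le_cos_of_nonneg_of_le_pi h0.le (Real.arccos_le_pi _) h6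
      have h8 := hgap j hj
      rw [Real.cos_arccos (by linarith [hσ0 j]) (by linarith)] at h7
      have := hσ0 j
      gcongr

end Discriminant
/-! ## Two subspaces -/

section TwoSubspaces

variable {K E : Type*} [NormedAddCommGroup K] [InnerProductSpace ℂ K] [NormedAddCommGroup E]
  [InnerProductSpace ℂ E] {S T : K →ₗ[ℂ] E} {D : K →ₗ[ℂ] K}

theorem norm_sq_add_of_isometry (hS : ∀ u v, inner ℂ (S u) (S v) = inner ℂ u v)
    (hT : ∀ u v, inner ℂ (T u) (T v) = inner ℂ u v)
    (hST : ∀ u v, inner ℂ (S u) (T v) = inner ℂ (D u) v) (a b : K) :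
    ‖S a + T b‖ ^ 2 = ‖a‖ ^ 2 + 2 * (inner ℂ (D a) b).re + ‖b‖ ^ 2 := by
  have h := @norm_add_sq ℂ E _ _ _ (S a) (T b)
  rw [hST, @norm_sq_eq_re_inner ℂ _ _ _ _ (S a), @norm_sq_eq_re_inner ℂ _ _ _ _ (T b), hS, hT,
    ← norm_sq_eq_re_inner, ← norm_sq_eq_re_inner] at h
  exact h

/-- For isometries `S`, `T` with `S† T = D` self-adjoint, a bound `1 - D² ≥ g` on an invariant
subspace carries over to the square of the difference of the projections onto the two ranges. -/
theorem gap_le_norm_sq_projection_sub (hS : ∀ u v, inner ℂ (S u) (S v) = inner ℂ u v)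
    (hT : ∀ u v, inner ℂ (T u) (T v) = inner ℂ u v)
    (hST : ∀ u v, inner ℂ (S u) (T v) = inner ℂ (D u) v) (hD : D.IsSymmetric)
    {V : Submodule ℂ K} (hV : ∀ v ∈ V, D v ∈ V) {g : ℝ} (hg0 : 0 ≤ g)
    (hg : ∀ v ∈ V, g * ‖v‖ ^ 2 ≤ ‖v‖ ^ 2 - ‖D v‖ ^ 2) {v w : K} (hv : v ∈ V) (hw : w ∈ V) :
    g * ‖S v + T w‖ ^ 2 ≤ ‖S (v + D w) - T (D v + w)‖ ^ 2 := by
  -- With `φ = S v + T w`, the vectors `S v'` and `T (D v + w)` are the projections of `φ` onto the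
  -- two ranges. `T w - S (D w)` is orthogonal to the range of `S`, and `D v + w = D v' + G`; this
  -- yields the two sums of squares `h1` and `h2`.
  set v' := v + D w with hv'
  set G := w - D (D w) with hG
  have hre : ∀ u, inner ℂ (D u) w = inner ℂ u (D w) := fun u => hD u w
  have h1 : ‖S v + T w‖ ^ 2 = ‖v'‖ ^ 2 + (‖w‖ ^ 2 - ‖D w‖ ^ 2) := by
    have h2 := @norm_add_sq ℂ K _ _ _ v (D w)
    rw [norm_sq_add_of_isometry hS hT hST, hre, hv', h2]
    simp only [RCLike.re_to_complex]
    ring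
  have h2 : ‖S v' - T (D v + w)‖ ^ 2 = (‖v'‖ ^ 2 - ‖D v'‖ ^ 2) + ‖G‖ ^ 2 := by
    have h3 := norm_sq_add_of_isometry hS hT hST v' (-(D v + w))
    have h4 := @norm_add_sq ℂ K _ _ _ (D v') (-(D v + w))
    have h5 : D v' + -(D v + w) = -G := by rw [hv', hG, map_add]; abel
    rw [h5, norm_neg, RCLike.re_to_complex] at h4
    rw [map_neg, ← sub_eq_add_neg] at h3
    rw [h3, h4]
    ring
  set x := ‖w‖ ^ 2 - ‖D w‖ ^ 2 with hx
  have hgw : g * ‖w‖ ^ 2 ≤ x := hg w hw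
  have hx0 : 0 ≤ x := (by positivity : 0 ≤ g * ‖w‖ ^ 2).trans hgw
  -- Cauchy–Schwarz for `x = ⟨w, (1 - D²) w⟩`. Together with `g ‖w‖² ≤ x` it gives `g x² ≤ x ‖G‖²`,
  -- whence `hxG`.
  have hcs : x ≤ ‖w‖ * ‖G‖ := by
    have h3 : x = RCLike.re (inner ℂ w G) := by
      rw [hG, inner_sub_right, map_sub, ← hD w (D w), ← norm_sq_eq_re_inner,
        ← norm_sq_eq_re_inner]
    rw [h3]
    exact re_inner_le_norm w G
  have hxG : g * x ≤ ‖G‖ ^ 2 := by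
    rcases hx0.eq_or_lt with h | h
    · rw [← h, mul_zero]; positivity
    · refine le_of_mul_le_mul_right ?_ h
      have h4 : x * x ≤ (‖w‖ * ‖G‖) * (‖w‖ * ‖G‖) := mul_self_le_mul_self hx0 hcs
      nlinarith [mul_le_mul_of_nonneg_left h4 hg0,
        mul_le_mul_of_nonneg_right hgw (sq_nonneg ‖G‖)]
  have hvV := hg v' (V.add_mem hv (hV w hw))
  rw [h1, h2]
  linarith

end TwoSubspaces

/-! ## Matrices acting on Euclidean space -/

section Euclidean

variable {l m n : Type*} [Fintype l] [Fintype m] [Fintype n]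

theorem inner_toLp_mulVec (A : Matrix l m ℂ) (B : Matrix l n ℂ) (u : m → ℂ) (v : n → ℂ) :
    inner ℂ (WithLp.toLp 2 (A *ᵥ u)) (WithLp.toLp 2 (B *ᵥ v)) =
      inner ℂ (WithLp.toLp 2 u) (WithLp.toLp 2 ((Aᴴ * B) *ᵥ v)) := by
  rw [EuclideanSpace.inner_toLp_toLp, EuclideanSpace.inner_toLp_toLp, Matrix.star_mulVec,
    dotProduct_comm, ← Matrix.dotProduct_mulVec, Matrix.mulVec_mulVec, dotProduct_comm]

theorem norm_toLp_mulVec [DecidableEq n] {M : Matrix m n ℂ} (hM : Mᴴ * M = 1) (v : n → ℂ) :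
    ‖WithLp.toLp 2 (M *ᵥ v)‖ = ‖WithLp.toLp 2 v‖ := by
  rw [@norm_eq_sqrt_re_inner ℂ, @norm_eq_sqrt_re_inner ℂ _ _ _ _ (WithLp.toLp 2 v),
    inner_toLp_mulVec, hM, Matrix.one_mulVec]

theorem norm_toLp_sq (v : n → ℂ) : ‖WithLp.toLp 2 v‖ ^ 2 = ∑ i, ‖v i‖ ^ 2 := by
  rw [EuclideanSpace.norm_sq_eq]

/-- Real and imaginary parts do not mix under a real matrix; this carries the bound on `D` over to
complex vectors. -/
theorem norm_map_ofReal_mulVec_sq (D : Matrix m n ℝ) (v : n → ℂ) :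
    ‖WithLp.toLp 2 (D.map (algebraMap ℝ ℂ) *ᵥ v)‖ ^ 2 =
      ∑ i, (D *ᵥ fun j => (v j).re) i ^ 2 + ∑ i, (D *ᵥ fun j => (v j).im) i ^ 2 := by
  rw [norm_toLp_sq, ← Finset.sum_add_distrib]
  refine Finset.sum_congr rfl fun i _ => ?_
  rw [Complex.sq_norm, Complex.normSq_apply, ← sq, ← sq]
  simp [Matrix.mulVec, dotProduct]

end Euclidean

/-! ## The isometries onto `𝒜` and `ℬ` -/

section Walk

variable {X : Type*} [Fintype X] [DecidableEq X] {P : Matrix X X ℝ} {π : X → ℝ}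

/-- The isometry `|x⟩ ↦ |x⟩|p_x⟩`. -/
noncomputable def matA (P : Matrix X X ℝ) : Matrix (X × X) X ℂ := Matrix.of fun p x => vecA P x p

/-- The isometry `|y⟩ ↦ |p*_y⟩|y⟩`. -/
noncomputable def matB (P : Matrix X X ℝ) (π : X → ℝ) : Matrix (X × X) X ℂ :=
  Matrix.of fun p y => vecB P π y p

/-- The discriminant as a complex matrix. -/
noncomputable def discC (P : Matrix X X ℝ) (π : X → ℝ) : Matrix X X ℂ :=
  (discriminant P π).map (algebraMap ℝ ℂ)

/-- The amplitudes `√(π x)`. -/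
noncomputable def sqrtDist (π : X → ℝ) : X → ℂ := fun x => ((√(π x) : ℝ) : ℂ)

theorem reflectionThrough_eq {ι n : Type*} [Fintype ι] [DecidableEq n] (v : ι → n → ℂ) :
    reflectionThrough v =
      (2 : ℂ) • ((Matrix.of fun p i => v i p) * (Matrix.of fun p i => v i p)ᴴ) - 1 := by
  rw [reflectionThrough]
  congr 2
  ext p q
  simp [Matrix.mul_apply, Matrix.sum_apply, Matrix.vecMulVec_apply]

theorem sqrt_mul_sqrt_ofReal {a : ℝ} (ha : 0 ≤ a) : ((√a : ℝ) : ℂ) * ((√a : ℝ) : ℂ) = (a : ℂ) := by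
  rw [← Complex.ofReal_mul, Real.mul_self_sqrt ha]

theorem matA_isometry (hP : P ∈ Matrix.rowStochastic ℝ X) : (matA P)ᴴ * matA P = 1 := by
  ext x x'
  rw [Matrix.mul_apply, Fintype.sum_prod_type]
  simp only [matA, vecA, Matrix.conjTranspose_apply, Matrix.of_apply]
  rw [Finset.sum_eq_single x (fun z _ hz => by simp [hz]) (by simp)]
  by_cases h : x = x'
  · subst h
    simp only [if_true, Complex.star_def, Complex.conj_ofReal, Matrix.one_apply_eq]
    simp only [sqrt_mul_sqrt_ofReal (Matrix.nonneg_of_mem_rowStochastic hP)]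
    rw [← Complex.ofReal_sum, Matrix.sum_row_of_mem_rowStochastic hP, Complex.ofReal_one]
  · simp [h]

theorem matB_isometry (hP : P ∈ Matrix.rowStochastic ℝ X) (hr : IsReversibleChain P π) :
    (matB P π)ᴴ * matB P π = 1 := by
  ext x x'
  rw [Matrix.mul_apply, Fintype.sum_prod_type_right]
  simp only [matB, vecB, Matrix.conjTranspose_apply, Matrix.of_apply,
    show timeReversal P π = P from hr]
  rw [Finset.sum_eq_single x (fun z _ hz => by simp [hz]) (by simp)]
  by_cases h : x = x'
  · subst h
    simp only [if_true, Complex.star_def, Complex.conj_ofReal, Matrix.one_apply_eq]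
    simp only [sqrt_mul_sqrt_ofReal (Matrix.nonneg_of_mem_rowStochastic hP)]
    rw [← Complex.ofReal_sum, Matrix.sum_row_of_mem_rowStochastic hP, Complex.ofReal_one]
  · simp [h]

/-- `|x⟩|p_x⟩` and `|p*_y⟩|y⟩` overlap only in the basis state `(x, y)`, so one product of roots
survives. -/
theorem matA_conjTranspose_mul_matB (hP : P ∈ Matrix.rowStochastic ℝ X) :
    (matA P)ᴴ * matB P π = discC P π := by
  ext x y
  rw [Matrix.mul_apply, Fintype.sum_prod_type]
  simp only [matA, matB, vecA, vecB, Matrix.conjTranspose_apply, Matrix.of_apply, discC,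
    Matrix.map_apply, discriminant]
  rw [Finset.sum_eq_single x (fun z _ hz => by simp [hz]) (by simp),
    Finset.sum_eq_single y (fun z _ hz => by simp [hz]) (by simp)]
  simp [Real.sqrt_mul (Matrix.nonneg_of_mem_rowStochastic hP)]

omit [Fintype X] [DecidableEq X] in
theorem discC_conjTranspose (hr : IsReversibleChain P π) : (discC P π)ᴴ = discC P π := by
  ext x y
  have := congrFun (congrFun (discriminant_isSymm hr) x) y
  rw [Matrix.transpose_apply] at this
  simp [discC, this]

theorem matB_conjTranspose_mul_matA (hP : P ∈ Matrix.rowStochastic ℝ X)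
    (hr : IsReversibleChain P π) : (matB P π)ᴴ * matA P = discC P π := by
  rw [← discC_conjTranspose hr, ← matA_conjTranspose_mul_matB hP, Matrix.conjTranspose_mul,
    Matrix.conjTranspose_conjTranspose]

theorem walk_eq (P : Matrix X X ℝ) (π : X → ℝ) :
    walk P π = ((2 : ℂ) • (matB P π * (matB P π)ᴴ) - 1) * ((2 : ℂ) • (matA P * (matA P)ᴴ) - 1) := by
  rw [walk, reflectionThrough_eq, reflectionThrough_eq]; rfl

theorem reflection_sq {m n : Type*} [Fintype m] [Fintype n] [DecidableEq m] [DecidableEq n]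
    {A : Matrix m n ℂ} (hA : Aᴴ * A = 1) :
    ((2 : ℂ) • (A * Aᴴ) - 1) * ((2 : ℂ) • (A * Aᴴ) - 1) = 1 := by
  have h : A * Aᴴ * (A * Aᴴ) = A * Aᴴ := by
    rw [Matrix.mul_assoc, ← Matrix.mul_assoc Aᴴ, hA, Matrix.one_mul]
  rw [sub_mul, mul_sub, mul_sub, smul_mul_smul_comm, h, Matrix.one_mul, Matrix.mul_one,
    Matrix.one_mul]
  module

theorem reflection_isometry {m n : Type*} [Fintype m] [Fintype n] [DecidableEq m] [DecidableEq n]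
    {A : Matrix m n ℂ} (hA : Aᴴ * A = 1) :
    ((2 : ℂ) • (A * Aᴴ) - 1)ᴴ * ((2 : ℂ) • (A * Aᴴ) - 1) = 1 := by
  have h : ((2 : ℂ) • (A * Aᴴ) - 1)ᴴ = (2 : ℂ) • (A * Aᴴ) - 1 := by
    simp [Matrix.conjTranspose_sub, Matrix.conjTranspose_smul, Matrix.conjTranspose_mul]
  rw [h, reflection_sq hA]

theorem walk_isometry (hP : P ∈ Matrix.rowStochastic ℝ X) (hr : IsReversibleChain P π) :
    (walk P π)ᴴ * walk P π = 1 := by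
  rw [walk_eq, Matrix.conjTranspose_mul, Matrix.mul_assoc, ← Matrix.mul_assoc _ (_ - 1) (_ - 1),
    reflection_isometry (matB_isometry hP hr), Matrix.one_mul,
    reflection_isometry (matA_isometry hP)]

theorem reflectA_apply (hP : P ∈ Matrix.rowStochastic ℝ X) (v w : X → ℂ) :
    ((2 : ℂ) • (matA P * (matA P)ᴴ) - 1) *ᵥ (matA P *ᵥ v + matB P π *ᵥ w) =
      (2 : ℂ) • (matA P *ᵥ (v + discC P π *ᵥ w)) - (matA P *ᵥ v + matB P π *ᵥ w) := by
  rw [Matrix.sub_mulVec, Matrix.one_mulVec, Matrix.smul_mulVec, ← Matrix.mulVec_mulVec,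
    Matrix.mulVec_add _ (matA P *ᵥ v), Matrix.mulVec_mulVec, Matrix.mulVec_mulVec, matA_isometry hP,
    matA_conjTranspose_mul_matB hP, Matrix.one_mulVec]

theorem reflectB_apply (hP : P ∈ Matrix.rowStochastic ℝ X) (hr : IsReversibleChain P π)
    (v w : X → ℂ) :
    ((2 : ℂ) • (matB P π * (matB P π)ᴴ) - 1) *ᵥ (matA P *ᵥ v + matB P π *ᵥ w) =
      (2 : ℂ) • (matB P π *ᵥ (discC P π *ᵥ v + w)) - (matA P *ᵥ v + matB P π *ᵥ w) := by
  rw [Matrix.sub_mulVec, Matrix.one_mulVec, Matrix.smul_mulVec, ← Matrix.mulVec_mulVec,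
    Matrix.mulVec_add _ (matA P *ᵥ v), Matrix.mulVec_mulVec, Matrix.mulVec_mulVec,
    matB_isometry hP hr, matB_conjTranspose_mul_matA hP hr, Matrix.one_mulVec]

/-! ## The stationary state and its complement -/

/-- The vectors in `ℂ^X` orthogonal to `√π`. -/
noncomputable def orthSqrt (π : X → ℝ) : Submodule ℂ (X → ℂ) :=
  LinearMap.ker (dotProductBilin ℂ ℂ (sqrtDist π))

end Walk
section Walk

variable {X : Type*} [Fintype X] [DecidableEq X] {P : Matrix X X ℝ} {π : X → ℝ}

omit [DecidableEq X] in
theorem mem_orthSqrt {v : X → ℂ} : v ∈ orthSqrt π ↔ sqrtDist π ⬝ᵥ v = 0 := Iff.rfl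

omit [DecidableEq X] in
theorem sqrtDist_dotProduct_self (hπ : IsStationaryDist P π) : sqrtDist π ⬝ᵥ sqrtDist π = 1 := by
  simp only [dotProduct, sqrtDist, sqrt_mul_sqrt_ofReal (hπ.nonneg _)]
  rw [← Complex.ofReal_sum, hπ.sum_eq_one, Complex.ofReal_one]

omit [Fintype X] [DecidableEq X] in
theorem star_sqrtDist : star (sqrtDist π) = sqrtDist π := by
  ext x; simp [sqrtDist]

theorem discC_mulVec_sqrtDist (hP : IsErgodicChain P) (hπ : IsStationaryDist P π)
    (hr : IsReversibleChain P π) : discC P π *ᵥ sqrtDist π = sqrtDist π := by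
  ext x
  simp only [Matrix.mulVec, dotProduct, discC, sqrtDist, Matrix.map_apply, Complex.coe_algebraMap]
  simp only [← Complex.ofReal_mul, sqrt_mul_discriminant hP hπ hr]
  rw [← Complex.ofReal_sum, ← Finset.mul_sum, Matrix.sum_row_of_mem_rowStochastic hP.stochastic,
    mul_one]

omit [Fintype X] [DecidableEq X] in
theorem discC_transpose (hr : IsReversibleChain P π) : (discC P π)ᵀ = discC P π := by
  rw [discC, ← Matrix.transpose_map, discriminant_isSymm hr]

theorem sqrtDist_dotProduct_discC (hP : IsErgodicChain P) (hπ : IsStationaryDist P π)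
    (hr : IsReversibleChain P π) (v : X → ℂ) :
    sqrtDist π ⬝ᵥ (discC P π *ᵥ v) = sqrtDist π ⬝ᵥ v := by
  rw [Matrix.dotProduct_mulVec, ← Matrix.mulVec_transpose, discC_transpose hr,
    discC_mulVec_sqrtDist hP hπ hr]

theorem discC_mulVec_mem (hP : IsErgodicChain P) (hπ : IsStationaryDist P π)
    (hr : IsReversibleChain P π) {v : X → ℂ} (hv : v ∈ orthSqrt π) :
    discC P π *ᵥ v ∈ orthSqrt π := by
  rw [mem_orthSqrt, sqrtDist_dotProduct_discC hP hπ hr, mem_orthSqrt.1 hv]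

theorem matA_mulVec_apply (P : Matrix X X ℝ) (v : X → ℂ) (p : X × X) :
    (matA P *ᵥ v) p = ((√(P p.1 p.2) : ℝ) : ℂ) * v p.1 := by
  simp only [Matrix.mulVec, dotProduct, matA, Matrix.of_apply, vecA]
  rw [Finset.sum_eq_single p.1 (fun z _ hz => by simp [hz.symm]) (by simp)]
  simp

theorem matB_mulVec_apply (hr : IsReversibleChain P π) (v : X → ℂ) (p : X × X) :
    (matB P π *ᵥ v) p = ((√(P p.2 p.1) : ℝ) : ℂ) * v p.2 := by
  simp only [Matrix.mulVec, dotProduct, matB, Matrix.of_apply, vecB,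
    show timeReversal P π = P from hr]
  rw [Finset.sum_eq_single p.2 (fun z _ hz => by simp [hz.symm]) (by simp)]
  simp

theorem matA_mulVec_eq_sum (P : Matrix X X ℝ) (v : X → ℂ) :
    matA P *ᵥ v = ∑ x, v x • vecA P x := by
  ext p
  simp [Matrix.mulVec, dotProduct, matA, mul_comm]

theorem matB_mulVec_eq_sum (P : Matrix X X ℝ) (π : X → ℝ) (v : X → ℂ) :
    matB P π *ᵥ v = ∑ x, v x • vecB P π x := by
  ext p
  simp [Matrix.mulVec, dotProduct, matB, mul_comm]

theorem matA_mulVec_sqrtDist (P : Matrix X X ℝ) (π : X → ℝ) :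
    matA P *ᵥ sqrtDist π = piState P π := matA_mulVec_eq_sum P _

/-- Detailed balance makes `|π⟩` symmetric in the two registers. It therefore lies in both `𝒜` and
`ℬ` and is fixed by both reflections. -/
theorem matB_mulVec_sqrtDist (hP : IsErgodicChain P) (hπ : IsStationaryDist P π)
    (hr : IsReversibleChain P π) : matB P π *ᵥ sqrtDist π = piState P π := by
  rw [← matA_mulVec_sqrtDist]
  ext p
  have h0 : ∀ x y, 0 ≤ P x y := fun _ _ => Matrix.nonneg_of_mem_rowStochastic hP.stochastic
  rw [matA_mulVec_apply, matB_mulVec_apply hr]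
  simp only [sqrtDist]
  rw [← Complex.ofReal_mul, ← Complex.ofReal_mul,
    ← Real.sqrt_mul (h0 _ _), ← Real.sqrt_mul (h0 _ _), mul_comm, detailed_balance hP hπ hr,
    mul_comm]

theorem star_piState_dotProduct (hP : IsErgodicChain P) (hπ : IsStationaryDist P π)
    (hr : IsReversibleChain P π) (v w : X → ℂ) :
    star (piState P π) ⬝ᵥ (matA P *ᵥ v + matB P π *ᵥ w) = sqrtDist π ⬝ᵥ (v + w) := by
  have hA : star (piState P π) ⬝ᵥ (matA P *ᵥ v) = sqrtDist π ⬝ᵥ v := by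
    rw [← matA_mulVec_sqrtDist, Matrix.star_mulVec, ← Matrix.dotProduct_mulVec,
      Matrix.mulVec_mulVec, matA_isometry hP.stochastic, Matrix.one_mulVec, star_sqrtDist]
  have hB : star (piState P π) ⬝ᵥ (matB P π *ᵥ w) = sqrtDist π ⬝ᵥ w := by
    rw [← matB_mulVec_sqrtDist hP hπ hr, Matrix.star_mulVec, ← Matrix.dotProduct_mulVec,
      Matrix.mulVec_mulVec, matB_isometry hP.stochastic hr, Matrix.one_mulVec, star_sqrtDist]
  rw [dotProduct_add, hA, hB, dotProduct_add]

theorem walk_mulVec_piState (hP : IsErgodicChain P) (hπ : IsStationaryDist P π)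
    (hr : IsReversibleChain P π) : walk P π *ᵥ piState P π = piState P π := by
  have hA := reflectA_apply (π := π) hP.stochastic (sqrtDist π) 0
  have hB := reflectB_apply hP.stochastic hr 0 (sqrtDist π)
  simp only [Matrix.mulVec_zero, add_zero, zero_add, matA_mulVec_sqrtDist,
    matB_mulVec_sqrtDist hP hπ hr] at hA hB
  rw [walk_eq, ← Matrix.mulVec_mulVec, hA, two_smul ℂ (piState P π),
    add_sub_cancel_right, hB, two_smul ℂ (piState P π), add_sub_cancel_right]

/-- The part of `𝒜 + ℬ` orthogonal to `|π⟩`. -/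
noncomputable def busySpace (P : Matrix X X ℝ) (π : X → ℝ) : Submodule ℂ (X × X → ℂ) :=
  (orthSqrt π).map (Matrix.toLin' (matA P)) ⊔ (orthSqrt π).map (Matrix.toLin' (matB P π))

theorem mem_busySpace {φ : X × X → ℂ} : φ ∈ busySpace P π ↔
    ∃ v ∈ orthSqrt π, ∃ w ∈ orthSqrt π, matA P *ᵥ v + matB P π *ᵥ w = φ := by
  simp [busySpace, Submodule.mem_sup]

/-- The coordinates `v`, `w` need not be orthogonal to `√π` one by one. Removing their `√π`
components removes a multiple of `|π⟩` from the sum, and orthogonality to `|π⟩` says that this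
multiple is zero. -/
theorem mem_busySpace_of_orthogonal (hP : IsErgodicChain P) (hπ : IsStationaryDist P π)
    (hr : IsReversibleChain P π) {ψ : X × X → ℂ} (hψ : ψ ∈ spaceA P ⊔ spaceB P π)
    (h : star (piState P π) ⬝ᵥ ψ = 0) : ψ ∈ busySpace P π := by
  obtain ⟨a, ha, b, hb, rfl⟩ := Submodule.mem_sup.1 hψ
  obtain ⟨v, rfl⟩ := (Submodule.mem_span_range_iff_exists_fun ℂ).1 ha
  obtain ⟨w, rfl⟩ := (Submodule.mem_span_range_iff_exists_fun ℂ).1 hb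
  rw [← matA_mulVec_eq_sum, ← matB_mulVec_eq_sum] at h ⊢
  rw [star_piState_dotProduct hP hπ hr, dotProduct_add] at h
  refine mem_busySpace.2 ⟨v - (sqrtDist π ⬝ᵥ v) • sqrtDist π, ?_,
    w - (sqrtDist π ⬝ᵥ w) • sqrtDist π, ?_, ?_⟩
  · rw [mem_orthSqrt, dotProduct_sub, dotProduct_smul, sqrtDist_dotProduct_self hπ]; simp
  · rw [mem_orthSqrt, dotProduct_sub, dotProduct_smul, sqrtDist_dotProduct_self hπ]; simp
  · rw [Matrix.mulVec_sub, Matrix.mulVec_sub, Matrix.mulVec_smul, Matrix.mulVec_smul,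
      matA_mulVec_sqrtDist, matB_mulVec_sqrtDist hP hπ hr, eq_neg_of_add_eq_zero_left h]
    module

theorem walk_mulVec_mem (hP : IsErgodicChain P) (hπ : IsStationaryDist P π)
    (hr : IsReversibleChain P π) {φ : X × X → ℂ} (hφ : φ ∈ busySpace P π) :
    walk P π *ᵥ φ ∈ busySpace P π := by
  obtain ⟨v, hv, w, hw, rfl⟩ := mem_busySpace.1 hφ
  have hD : ∀ {u}, u ∈ orthSqrt π → discC P π *ᵥ u ∈ orthSqrt π := discC_mulVec_mem hP hπ hr
  -- In coordinates `ref(𝒜)` sends `(v, w)` to `(v', -w)`, and `ref(ℬ)` sends that to `(-v', -w + 2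
  -- D v')`; `D` preserves the complement of `√π`.
  set v' := v + (2 : ℂ) • (discC P π *ᵥ w) with hv'
  have hv'm : v' ∈ orthSqrt π := add_mem hv (Submodule.smul_mem _ _ (hD hw))
  refine mem_busySpace.2 ⟨-v', neg_mem hv'm, -w + (2 : ℂ) • (discC P π *ᵥ v'),
    add_mem (neg_mem hw) (Submodule.smul_mem _ _ (hD hv'm)), ?_⟩
  have h1 : (2 : ℂ) • (matA P *ᵥ (v + discC P π *ᵥ w)) - (matA P *ᵥ v + matB P π *ᵥ w) =
      matA P *ᵥ v' + matB P π *ᵥ (-w) := by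
    rw [hv', Matrix.mulVec_add, Matrix.mulVec_add, Matrix.mulVec_smul, Matrix.mulVec_neg]
    module
  rw [walk_eq, ← Matrix.mulVec_mulVec, reflectA_apply hP.stochastic, h1,
    reflectB_apply hP.stochastic hr]
  simp only [Matrix.mulVec_add, Matrix.mulVec_smul, Matrix.mulVec_neg]
  module

omit [DecidableEq X] in
theorem norm_discC_mulVec_sq_le {θ : ℝ} (hθ : ∀ v : X → ℝ, ∑ x, √(π x) * v x = 0 →
      ∑ x, (discriminant P π *ᵥ v) x ^ 2 ≤ Real.cos θ ^ 2 * ∑ x, v x ^ 2)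
    {v : X → ℂ} (hv : v ∈ orthSqrt π) :
    ‖WithLp.toLp 2 (discC P π *ᵥ v)‖ ^ 2 ≤ Real.cos θ ^ 2 * ‖WithLp.toLp 2 v‖ ^ 2 := by
  have h : ∑ x, ((√(π x) : ℝ) : ℂ) * v x = 0 := hv
  have hre : ∑ x, √(π x) * (v x).re = 0 := by simpa using congrArg Complex.re h
  have him : ∑ x, √(π x) * (v x).im = 0 := by simpa using congrArg Complex.im h
  rw [discC, norm_map_ofReal_mulVec_sq, norm_toLp_sq]
  have h3 : ∑ x, ‖v x‖ ^ 2 = ∑ x, (v x).re ^ 2 + ∑ x, (v x).im ^ 2 := by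
    rw [← Finset.sum_add_distrib]
    refine Finset.sum_congr rfl fun x _ => ?_
    rw [Complex.sq_norm, Complex.normSq_apply, ← sq, ← sq]
  rw [h3, mul_add]
  exact add_le_add (hθ _ hre) (hθ _ him)

/-- On the busy subspace the walk moves every vector by at least the chord of the phase gap. -/
theorem le_norm_sub_walk (hP : IsErgodicChain P) (hπ : IsStationaryDist P π)
    (hr : IsReversibleChain P π) {θ : ℝ} (h0 : 0 ≤ θ) (hπ2 : θ ≤ Real.pi / 2)
    (hθ : ∀ v : X → ℝ, ∑ x, √(π x) * v x = 0 →
      ∑ x, (discriminant P π *ᵥ v) x ^ 2 ≤ Real.cos θ ^ 2 * ∑ x, v x ^ 2)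
    {φ : X × X → ℂ} (hφ : φ ∈ busySpace P π) :
    2 * Real.sin θ * ‖WithLp.toLp 2 φ‖ ≤ ‖WithLp.toLp 2 (φ - walk P π *ᵥ φ)‖ := by
  obtain ⟨v, hv, w, hw, rfl⟩ := mem_busySpace.1 hφ
  have hs : 0 ≤ Real.sin θ := Real.sin_nonneg_of_nonneg_of_le_pi h0 (by linarith [Real.pi_pos])
  have key := gap_le_norm_sq_projection_sub (S := Matrix.toEuclideanLin (matA P))
    (T := Matrix.toEuclideanLin (matB P π)) (D := Matrix.toEuclideanLin (discC P π))
    (V := (orthSqrt π).comap (WithLp.linearEquiv 2 ℂ (X → ℂ)).toLinearMap)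
    (g := Real.sin θ ^ 2) (v := WithLp.toLp 2 v) (w := WithLp.toLp 2 w)
    (fun a b => by
      have := inner_toLp_mulVec (matA P) (matA P) a.ofLp b.ofLp
      rwa [matA_isometry hP.stochastic, Matrix.one_mulVec] at this)
    (fun a b => by
      have := inner_toLp_mulVec (matB P π) (matB P π) a.ofLp b.ofLp
      rwa [matB_isometry hP.stochastic hr, Matrix.one_mulVec] at this)
    (fun a b => by
      have h1 := inner_toLp_mulVec (matA P) (matB P π) a.ofLp b.ofLp
      have h2 := inner_toLp_mulVec (discC P π) 1 a.ofLp b.ofLp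
      rw [matA_conjTranspose_mul_matB hP.stochastic] at h1
      rw [discC_conjTranspose hr, Matrix.mul_one, Matrix.one_mulVec] at h2
      exact h1.trans h2.symm)
    (fun a b => by
      have h1 := inner_toLp_mulVec (discC P π) 1 a.ofLp b.ofLp
      rw [discC_conjTranspose hr, Matrix.mul_one, Matrix.one_mulVec] at h1
      exact h1)
    (fun a ha => discC_mulVec_mem hP hπ hr ha) (sq_nonneg _)
    (fun a ha => by
      have h1 : ‖(Matrix.toEuclideanLin (discC P π)) a‖ ^ 2 ≤ Real.cos θ ^ 2 * ‖a‖ ^ 2 :=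
        norm_discC_mulVec_sq_le hθ ha
      rw [Real.sin_sq]
      linarith) hv hw
  set φ := matA P *ᵥ v + matB P π *ᵥ w with hφd
  set RA := (2 : ℂ) • (matA P * (matA P)ᴴ) - 1 with hRA
  set RB := (2 : ℂ) • (matB P π * (matB P π)ᴴ) - 1 with hRB
  -- As `ref(ℬ)` is an isometric involution, `‖φ - Wφ‖` is the distance between the two reflected
  -- vectors, that is, twice the distance between the projections.
  have h1 : φ - walk P π *ᵥ φ = RB *ᵥ (RB *ᵥ φ - RA *ᵥ φ) := by
    rw [Matrix.mulVec_sub, Matrix.mulVec_mulVec, Matrix.mulVec_mulVec, hRB,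
      reflection_sq (matB_isometry hP.stochastic hr), Matrix.one_mulVec, walk_eq]
  have h2 : RB *ᵥ φ - RA *ᵥ φ = (-2 : ℂ) • (matA P *ᵥ (v + discC P π *ᵥ w) -
      matB P π *ᵥ (discC P π *ᵥ v + w)) := by
    rw [reflectA_apply hP.stochastic, reflectB_apply hP.stochastic hr]
    module
  rw [h1, norm_toLp_mulVec (reflection_isometry (matB_isometry hP.stochastic hr)), h2,
    WithLp.toLp_smul, norm_smul, norm_neg, Complex.norm_ofNat, mul_assoc]
  have h3 : (Real.sin θ * ‖WithLp.toLp 2 φ‖) ^ 2 ≤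
      ‖WithLp.toLp 2 (matA P *ᵥ (v + discC P π *ᵥ w) - matB P π *ᵥ (discC P π *ᵥ v + w))‖ ^ 2 := by
    rw [mul_pow]
    exact key
  have := abs_le_of_sq_le_sq h3 (norm_nonneg _)
  linarith [le_abs_self (Real.sin θ * ‖WithLp.toLp 2 φ‖)]

end Walk
/-! ## Averages of powers of the walk -/

open Polynomial in
/-- The polynomial `2⁻ˢ ∑ m < 2ˢ, Xᵐ` in factored form. -/
noncomputable def phaseKernel (s : ℕ) : ℂ[X] :=
  ∏ j ∈ Finset.range s, (C (1 / 2) * (1 + X ^ 2 ^ j))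

open Polynomial in
-- Repeated use of `(1 - Y)(1 + Y) = 1 - Y²` with `Y = X ^ 2 ^ j`.
theorem phaseKernel_mul (s : ℕ) :
    phaseKernel s * (1 - X) = C ((1 / 2) ^ s) * (1 - X ^ 2 ^ s) := by
  induction s with
  | zero => simp [phaseKernel]
  | succ s ih =>
    rw [phaseKernel, Finset.prod_range_succ, ← phaseKernel, mul_right_comm, ih, pow_succ (1 / 2),
      C_mul, pow_succ 2 s, pow_mul]
    ring

section Walk

variable {X : Type*} [Fintype X] [DecidableEq X] {P : Matrix X X ℝ} {π : X → ℝ}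

open Polynomial in
theorem aeval_mulVec_mem {n : Type*} [Fintype n] [DecidableEq n] {W : Matrix n n ℂ}
    {N : Submodule ℂ (n → ℂ)} (hN : ∀ φ ∈ N, W *ᵥ φ ∈ N) (p : ℂ[X]) {φ : n → ℂ} (hφ : φ ∈ N) :
    aeval W p *ᵥ φ ∈ N := by
  induction p using Polynomial.induction_on' with
  | add p q hp hq => rw [map_add, Matrix.add_mulVec]; exact add_mem hp hq
  | monomial n a =>
    have h : ∀ n, W ^ n *ᵥ φ ∈ N := fun n => by
      induction n with
      | zero => simpa using hφ
      | succ n ih => rw [pow_succ', ← Matrix.mulVec_mulVec]; exact hN _ ih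
    rw [aeval_monomial, ← Algebra.smul_def, Matrix.smul_mulVec]
    exact N.smul_mem a (h n)

theorem conjTranspose_mul_pow {n : Type*} [Fintype n] [DecidableEq n] {W : Matrix n n ℂ}
    (hW : Wᴴ * W = 1) (m : ℕ) : (W ^ m)ᴴ * W ^ m = 1 := by
  have h : W ∈ Matrix.unitaryGroup n ℂ := Matrix.mem_unitaryGroup_iff'.2 hW
  exact Matrix.mem_unitaryGroup_iff'.1 (pow_mem h m)

/-- The lower bound makes `1 - W` injective on the invariant space `busySpace`, hence surjective in
finite dimension. -/
theorem exists_sub_walk_eq (hP : IsErgodicChain P) (hπ : IsStationaryDist P π)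
    (hr : IsReversibleChain P π) {a : ℝ} (ha : 0 < a)
    (h : ∀ φ ∈ busySpace P π,
      a * ‖WithLp.toLp 2 φ‖ ≤ ‖WithLp.toLp 2 (φ - walk P π *ᵥ φ)‖)
    {φ : X × X → ℂ} (hφ : φ ∈ busySpace P π) :
    ∃ χ ∈ busySpace P π, χ - walk P π *ᵥ χ = φ := by
  set f : busySpace P π →ₗ[ℂ] busySpace P π :=
    (LinearMap.id - Matrix.toLin' (walk P π)).restrict (fun χ hχ =>
      sub_mem hχ (walk_mulVec_mem hP hπ hr hχ)) with hf
  have hinj : Function.Injective f := by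
    rw [← LinearMap.ker_eq_bot, LinearMap.ker_eq_bot']
    intro χ hχ
    have h1 : (χ : X × X → ℂ) - walk P π *ᵥ χ = 0 := congrArg Subtype.val hχ
    have h2 := h χ χ.2
    rw [h1, WithLp.toLp_zero, norm_zero] at h2
    have h3 : ‖WithLp.toLp 2 (χ : X × X → ℂ)‖ = 0 :=
      le_antisymm (nonpos_of_mul_nonpos_right h2 ha) (norm_nonneg _)
    exact Subtype.ext (by simpa using h3)
  obtain ⟨χ, hχ⟩ := LinearMap.injective_iff_surjective.1 hinj ⟨φ, hφ⟩
  exact ⟨χ, χ.2, congrArg Subtype.val hχ⟩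

open Polynomial in
theorem norm_phaseKernel_mulVec_le (hP : IsErgodicChain P) (hπ : IsStationaryDist P π)
    (hr : IsReversibleChain P π) {θ : ℝ} (h0 : 0 < θ) (hπ2 : θ ≤ Real.pi / 2)
    (hθ : ∀ v : X → ℝ, ∑ x, √(π x) * v x = 0 →
      ∑ x, (discriminant P π *ᵥ v) x ^ 2 ≤ Real.cos θ ^ 2 * ∑ x, v x ^ 2)
    {s : ℕ} (hs : 2 * Real.pi / θ ≤ 2 ^ s) {φ : X × X → ℂ} (hφ : φ ∈ busySpace P π) :
    ‖WithLp.toLp 2 (aeval (walk P π) (phaseKernel s) *ᵥ φ)‖ ≤ 1 / 4 * ‖WithLp.toLp 2 φ‖ := by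
  have hpi := Real.pi_pos
  -- Jordan's inequality, so that `‖χ‖ ≤ π ‖φ‖ / (4 θ)`. With `2⁻ˢ ≤ θ / (2π)` and the factor 2 from
  -- `‖χ - W ^ 2 ^ s χ‖ ≤ 2 ‖χ‖`, the product is 1/4.
  have hsin : 2 / Real.pi * θ ≤ Real.sin θ := Real.mul_le_sin h0.le hπ2
  have hsin0 : 0 < Real.sin θ := lt_of_lt_of_le (by positivity) hsin
  obtain ⟨χ, hχ, rfl⟩ := exists_sub_walk_eq hP hπ hr (a := 2 * Real.sin θ) (by positivity)
    (fun φ hφ => le_norm_sub_walk hP hπ hr h0.le hπ2 hθ hφ) hφ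
  have h1 := le_norm_sub_walk hP hπ hr h0.le hπ2 hθ hχ
  set W := walk P π with hW
  have h2 : aeval W (phaseKernel s) *ᵥ (χ - W *ᵥ χ) = ((1 / 2 : ℂ) ^ s) • (χ - W ^ 2 ^ s *ᵥ χ) := by
    have h3 : χ - W *ᵥ χ = aeval W (1 - Polynomial.X : Polynomial ℂ) *ᵥ χ := by
      simp [Matrix.sub_mulVec]
    rw [h3, Matrix.mulVec_mulVec, ← map_mul, phaseKernel_mul, map_mul, aeval_C, ← Algebra.smul_def,
      Matrix.smul_mulVec]
    simp [Matrix.sub_mulVec]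
  rw [h2, WithLp.toLp_smul, norm_smul, norm_pow, norm_div, norm_one, Complex.norm_ofNat]
  have h4 : ‖WithLp.toLp 2 (χ - W ^ 2 ^ s *ᵥ χ)‖ ≤ 2 * ‖WithLp.toLp 2 χ‖ := by
    rw [WithLp.toLp_sub]
    refine (norm_sub_le _ _).trans ?_
    rw [norm_toLp_mulVec (conjTranspose_mul_pow (walk_isometry hP.stochastic hr) _), two_mul]
  have h5 : (1 / 2 : ℝ) ^ s ≤ θ / (2 * Real.pi) := by
    rw [one_div, inv_pow, ← inv_div]
    exact inv_anti₀ (by positivity) hs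
  have h6 : 4 * θ / Real.pi * ‖WithLp.toLp 2 χ‖ ≤ ‖WithLp.toLp 2 (χ - W *ᵥ χ)‖ := by
    refine le_trans (mul_le_mul_of_nonneg_right ?_ (norm_nonneg _)) h1
    calc 4 * θ / Real.pi = 2 * (2 / Real.pi * θ) := by ring
      _ ≤ _ := by linarith
  calc (1 / 2 : ℝ) ^ s * ‖WithLp.toLp 2 (χ - W ^ 2 ^ s *ᵥ χ)‖
      ≤ θ / (2 * Real.pi) * (2 * ‖WithLp.toLp 2 χ‖) := by gcongr
    _ = 1 / 4 * (4 * θ / Real.pi * ‖WithLp.toLp 2 χ‖) := by ring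
    _ ≤ _ := by linarith

open Polynomial in
theorem norm_phaseKernel_pow_mulVec_le (hP : IsErgodicChain P) (hπ : IsStationaryDist P π)
    (hr : IsReversibleChain P π) {θ : ℝ} (h0 : 0 < θ) (hπ2 : θ ≤ Real.pi / 2)
    (hθ : ∀ v : X → ℝ, ∑ x, √(π x) * v x = 0 →
      ∑ x, (discriminant P π *ᵥ v) x ^ 2 ≤ Real.cos θ ^ 2 * ∑ x, v x ^ 2)
    {s : ℕ} (hs : 2 * Real.pi / θ ≤ 2 ^ s) (k : ℕ) {φ : X × X → ℂ} (hφ : φ ∈ busySpace P π) :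
    ‖WithLp.toLp 2 (aeval (walk P π) (phaseKernel s ^ k) *ᵥ φ)‖ ≤
      (1 / 4) ^ k * ‖WithLp.toLp 2 φ‖ := by
  induction k with
  | zero => simp
  | succ k ih =>
    rw [pow_succ', map_mul, ← Matrix.mulVec_mulVec, pow_succ', mul_assoc]
    refine (norm_phaseKernel_mulVec_le hP hπ hr h0 hπ2 hθ hs
      (aeval_mulVec_mem (fun _ h => walk_mulVec_mem hP hπ hr h) _ hφ)).trans ?_
    gcongr

end Walk
/-! ## Gates and circuits -/

section Circuits

variable {X A : Type*} [Fintype X] [DecidableEq X] [Fintype A] [DecidableEq A]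
  {V₁ V₂ : Matrix (X × X) (X × X) ℂ} {o : X} {M : Finset X}

theorem blockDiagonal_mulVec_apply {m o R : Type*} [Fintype m] [Fintype o] [DecidableEq o]
    [NonUnitalNonAssocSemiring R] (F : o → Matrix m m R) (Ψ : m × o → R) (b : m × o) :
    (Matrix.blockDiagonal F *ᵥ Ψ) b = (F b.2 *ᵥ fun p => Ψ (p, b.2)) b.1 := by
  simp only [Matrix.mulVec, dotProduct, Fintype.sum_prod_type, Matrix.blockDiagonal_apply]
  refine Finset.sum_congr rfl fun p _ => ?_
  rw [Finset.sum_eq_single b.2 (fun z _ hz => by simp [hz.symm]) (by simp)]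
  simp

theorem hadamard_mulVec (q : A) (Ψ : (X × X) × (A → Bool) → ℂ) (b : (X × X) × (A → Bool)) :
    ((Gate.hadamard q).op V₁ V₂ o M *ᵥ Ψ) b =
      (Ψ (b.1, Function.update b.2 q false) +
        (if b.2 q = true then -1 else 1) * Ψ (b.1, Function.update b.2 q true)) /
          ((√2 : ℝ) : ℂ) := by
  simp only [Gate.op, Matrix.mulVec, dotProduct, Matrix.of_apply]
  have hne : (b.1, Function.update b.2 q false) ≠ (b.1, Function.update b.2 q true) := by
    intro h
    have := congrFun (congrArg Prod.snd h) q
    simp at this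
  have hc : ∀ v, b.1 = (b.1, Function.update b.2 q v).1 ∧
      ∀ r, r ≠ q → b.2 r = (b.1, Function.update b.2 q v).2 r :=
    fun v => ⟨rfl, fun r h => by simp [h]⟩
  rw [Fintype.sum_eq_add _ _ hne, if_pos (hc false), if_pos (hc true)]
  · simp only [Function.update_self, and_true, Bool.false_eq_true, and_false, if_false]
    ring
  · intro b' hb'
    rw [if_neg, zero_mul]
    rintro ⟨h1, h2⟩
    have h3 : ∀ v, b'.2 q = v → b' = (b.1, Function.update b.2 q v) := fun v hv => by
      refine Prod.ext h1.symm (funext fun r => ?_)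
      by_cases hrq : r = q
      · subst hrq; simp [hv]
      · simp [hrq, (h2 r hrq).symm]
    cases hv : b'.2 q
    · exact hb'.1 (h3 _ hv)
    · exact hb'.2 (h3 _ hv)

theorem hadamard_conjTranspose (q : A) :
    ((Gate.hadamard q).op V₁ V₂ o M)ᴴ = (Gate.hadamard q).op V₁ V₂ o M := by
  ext b b'
  have h : (b'.1 = b.1 ∧ ∀ r, r ≠ q → b'.2 r = b.2 r) ↔
      (b.1 = b'.1 ∧ ∀ r, r ≠ q → b.2 r = b'.2 r) := by
    constructor <;> exact fun h => ⟨h.1.symm, fun r hr => (h.2 r hr).symm⟩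
  simp only [Gate.op, Matrix.conjTranspose_apply, Matrix.of_apply, h, and_comm (a := b'.2 q = true)]
  split_ifs <;> simp

theorem hadamard_mul_self (q : A) :
    (Gate.hadamard q).op V₁ V₂ o M * (Gate.hadamard q).op V₁ V₂ o M = 1 := by
  refine Matrix.ext_of_mulVec_single fun i => ?_
  generalize (Pi.single i (1 : ℂ) : (X × X) × (A → Bool) → ℂ) = Ψ
  have h2 : ((√2 : ℝ) : ℂ) * ((√2 : ℝ) : ℂ) = 2 := by
    rw [sqrt_mul_sqrt_ofReal (by norm_num)]; norm_num
  rw [← Matrix.mulVec_mulVec, Matrix.one_mulVec]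
  ext ⟨p, a⟩
  simp only [hadamard_mulVec, Function.update_idem, Function.update_self]
  rw [← mul_div_assoc, ← add_div, div_div, h2]
  by_cases ha : a q = true
  · have : Function.update a q true = a := by rw [← ha, Function.update_eq_self]
    simp [this, ha]
    ring
  · have : Function.update a q false = a := by
      rw [← Bool.eq_false_of_not_eq_true ha, Function.update_eq_self]
    simp [this, ha]
    ring

theorem diagonal_sign_conjTranspose {n : Type*} [DecidableEq n] (p : n → Prop) [DecidablePred p]
    (a c : ℂ) (ha : star a = a) (hc : star c = c) :
    (Matrix.diagonal fun b => if p b then a else c)ᴴ =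
      Matrix.diagonal fun b => if p b then a else c := by
  rw [Matrix.diagonal_conjTranspose]
  congr 1
  ext b
  simp only [Pi.star_apply]
  split_ifs <;> assumption

theorem diagonal_sign_mul_self {n : Type*} [Fintype n] [DecidableEq n] (p : n → Prop)
    [DecidablePred p] (a c : ℂ) (ha : a * a = 1) (hc : c * c = 1) :
    (Matrix.diagonal fun b => if p b then a else c) *
      (Matrix.diagonal fun b => if p b then a else c) = 1 := by
  rw [Matrix.diagonal_mul_diagonal, ← Matrix.diagonal_one]
  congr 1
  ext b
  split_ifs <;> assumption

theorem Gate.inv_op (g : Gate A) : g.inv.op V₁ V₂ o M = (g.op V₁ V₂ o M)ᴴ := by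
  cases g
  case hadamard q => exact (hadamard_conjTranspose q).symm
  case check => exact (diagonal_sign_conjTranspose _ _ _ (by simp) (by simp)).symm
  case ctrlRefA q => exact (diagonal_sign_conjTranspose _ _ _ (by simp) (by simp)).symm
  case ctrlRefB q => exact (diagonal_sign_conjTranspose _ _ _ (by simp) (by simp)).symm
  case zeroRef => exact (diagonal_sign_conjTranspose _ _ _ (by simp) (by simp)).symm
  all_goals simp [Gate.inv, Gate.op, Matrix.conjTranspose_kronecker]

theorem Gate.op_isometry (h₁ : V₁ ∈ Matrix.unitaryGroup (X × X) ℂ)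
    (h₂ : V₂ ∈ Matrix.unitaryGroup (X × X) ℂ) (g : Gate A) :
    (g.op V₁ V₂ o M)ᴴ * g.op V₁ V₂ o M = 1 := by
  have h1 : V₁ᴴ * V₁ = 1 := Matrix.mem_unitaryGroup_iff'.1 h₁
  have h1' : V₁ * V₁ᴴ = 1 := Matrix.mem_unitaryGroup_iff.1 h₁
  have h2 : V₂ᴴ * V₂ = 1 := Matrix.mem_unitaryGroup_iff'.1 h₂
  have h2' : V₂ * V₂ᴴ = 1 := Matrix.mem_unitaryGroup_iff.1 h₂
  cases g
  case hadamard q => rw [hadamard_conjTranspose, hadamard_mul_self]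
  case check =>
    simp only [Gate.op]
    rw [diagonal_sign_conjTranspose _ _ _ (by simp) (by simp),
      diagonal_sign_mul_self _ _ _ (by simp) (by simp)]
  case ctrlRefA q =>
    simp only [Gate.op]
    rw [diagonal_sign_conjTranspose _ _ _ (by simp) (by simp),
      diagonal_sign_mul_self _ _ _ (by simp) (by simp)]
  case ctrlRefB q =>
    simp only [Gate.op]
    rw [diagonal_sign_conjTranspose _ _ _ (by simp) (by simp),
      diagonal_sign_mul_self _ _ _ (by simp) (by simp)]
  case zeroRef =>
    simp only [Gate.op]
    rw [diagonal_sign_conjTranspose _ _ _ (by simp) (by simp),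
      diagonal_sign_mul_self _ _ _ (by simp) (by simp)]
  all_goals
    simp only [Gate.op, Matrix.conjTranspose_kronecker, ← Matrix.mul_kronecker_mul,
      Matrix.conjTranspose_conjTranspose, Matrix.conjTranspose_one, Matrix.mul_one, h1, h1', h2,
      h2', Matrix.one_kronecker_one]

theorem circuitOp_append (c d : List (Gate A)) :
    circuitOp V₁ V₂ o M (c ++ d) = circuitOp V₁ V₂ o M d * circuitOp V₁ V₂ o M c := by
  induction c with
  | nil => simp [circuitOp]
  | cons g c ih => rw [List.cons_append, circuitOp, circuitOp, ih, Matrix.mul_assoc]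

theorem circuitOp_singleton (g : Gate A) : circuitOp V₁ V₂ o M [g] = g.op V₁ V₂ o M := by
  simp [circuitOp]

theorem circuitOp_inv (c : List (Gate A)) :
    circuitOp V₁ V₂ o M (circuitInv c) = (circuitOp V₁ V₂ o M c)ᴴ := by
  induction c with
  | nil => simp [circuitOp, circuitInv]
  | cons g c ih =>
    rw [circuitInv, List.reverse_cons, List.map_append, circuitOp_append, ← circuitInv, ih,
      List.map_singleton, circuitOp_singleton, Gate.inv_op, circuitOp, Matrix.conjTranspose_mul]

theorem circuitOp_isometry (h₁ : V₁ ∈ Matrix.unitaryGroup (X × X) ℂ)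
    (h₂ : V₂ ∈ Matrix.unitaryGroup (X × X) ℂ) (c : List (Gate A)) :
    (circuitOp V₁ V₂ o M c)ᴴ * circuitOp V₁ V₂ o M c = 1 := by
  induction c with
  | nil => simp [circuitOp]
  | cons g c ih =>
    rw [circuitOp, Matrix.conjTranspose_mul, Matrix.mul_assoc,
      ← Matrix.mul_assoc (circuitOp V₁ V₂ o M c)ᴴ, ih, Matrix.one_mul, Gate.op_isometry h₁ h₂]

/-! ## The controlled walk -/

omit [Fintype X] in
theorem controlled_eq_blockDiagonal (q : A) (W : Matrix (X × X) (X × X) ℂ) :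
    controlled q W = Matrix.blockDiagonal fun a => if a q = true then W else 1 := by
  ext ⟨p, a⟩ ⟨p', a'⟩
  simp only [controlled, Matrix.of_apply, Matrix.blockDiagonal_apply]
  split_ifs <;> rfl

/-- The sign matrix is `2 J J† - 1` for the inclusion `J` of the basis states `e x`, and `V J` has
the columns `v x`. So only the prescribed values of the update matter, not its arbitrary extension.
-/
theorem conj_diagonal_sign_eq {n m : Type*} [Fintype n] [DecidableEq n] [Fintype m] [DecidableEq m]
    {V : Matrix n n ℂ} (hV : V ∈ Matrix.unitaryGroup n ℂ) {v : m → n → ℂ} (e : m → n)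
    (he : Function.Injective e) (h : ∀ x, V *ᵥ Pi.single (e x) 1 = v x) (p : n → Prop)
    [DecidablePred p] (hp : ∀ i, ¬ p i ↔ ∃ x, e x = i) :
    V * (Matrix.diagonal fun i => if p i then -1 else 1) * Vᴴ = reflectionThrough v := by
  set J : Matrix n m ℂ := Matrix.of fun i x => if i = e x then 1 else 0 with hJ
  have h1 : (Matrix.diagonal fun i => if p i then (-1 : ℂ) else 1) = (2 : ℂ) • (J * Jᴴ) - 1 := by
    ext i j
    simp only [Matrix.sub_apply, Matrix.smul_apply, Matrix.mul_apply, hJ, Matrix.of_apply,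
      Matrix.conjTranspose_apply, Matrix.diagonal_apply, Matrix.one_apply]
    by_cases hi : p i
    · have : ∀ x, i ≠ e x := fun x hx => ((hp i).2 ⟨x, hx.symm⟩) hi
      simp [this, hi, apply_ite]
    · obtain ⟨x, rfl⟩ := (hp i).1 hi
      rw [Finset.sum_eq_single x (fun z _ hz => by simp [he.ne hz.symm]) (by simp)]
      simp only [hi, if_false, if_true, one_mul]
      by_cases hij : e x = j
      · simp [hij]; norm_num
      · simp [hij, Ne.symm hij]
  have h2 : V * J = Matrix.of fun i x => v x i := by
    ext i x
    rw [Matrix.of_apply, ← h x]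
    simp [Matrix.mul_apply, hJ]
  have h3 : V * Vᴴ = 1 := Matrix.mem_unitaryGroup_iff.1 hV
  rw [h1, reflectionThrough_eq, ← h2, Matrix.mul_sub, Matrix.sub_mul, Matrix.mul_one, h3,
    Matrix.mul_smul, Matrix.smul_mul, Matrix.conjTranspose_mul]
  simp only [Matrix.mul_assoc]

variable {P : Matrix X X ℝ} {π : X → ℝ}

/-- It suffices to control the reflections: where the qubit is 0, each update cancels against its
inverse. -/
theorem circuitOp_ctrlWalk (h₁ : IsUpdateA P o V₁) (h₂ : IsUpdateB P π o V₂) (q : A) :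
    circuitOp V₁ V₂ o M (ctrlWalk q) = controlled q (walk P π) := by
  have hA : (Gate.ctrlRefA q).op V₁ V₂ o M = Matrix.blockDiagonal fun a : A → Bool =>
      Matrix.diagonal fun p : X × X => if a q = true ∧ p.2 ≠ o then (-1 : ℂ) else 1 := by
    rw [Matrix.blockDiagonal_diagonal]; rfl
  have hB : (Gate.ctrlRefB q).op V₁ V₂ o M = Matrix.blockDiagonal fun a : A → Bool =>
      Matrix.diagonal fun p : X × X => if a q = true ∧ p.1 ≠ o then (-1 : ℂ) else 1 := by
    rw [Matrix.blockDiagonal_diagonal]; rfl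
  have h3 : V₁ * V₁ᴴ = 1 := Matrix.mem_unitaryGroup_iff.1 h₁.1
  have h4 : V₂ * V₂ᴴ = 1 := Matrix.mem_unitaryGroup_iff.1 h₂.1
  simp only [ctrlWalk, circuitOp, Matrix.one_mul]
  rw [hA, hB]
  simp only [Gate.op, Matrix.kronecker_one, ← Matrix.blockDiagonal_mul, controlled_eq_blockDiagonal]
  congr 1
  ext1 a
  by_cases ha : a q = true
  · simp only [ha, true_and, if_true]
    have hA' := conj_diagonal_sign_eq h₁.1 (fun x => (x, o))
      (fun x y h => congrArg Prod.fst h) h₁.2 (fun p => p.2 ≠ o)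
      (fun p => ⟨fun h => ⟨p.1, Prod.ext rfl (not_not.1 h).symm⟩, by rintro ⟨x, rfl⟩; simp⟩)
    have hB' := conj_diagonal_sign_eq h₂.1 (fun y => (o, y))
      (fun x y h => congrArg Prod.snd h) h₂.2 (fun p => p.1 ≠ o)
      (fun p => ⟨fun h => ⟨p.2, Prod.ext (not_not.1 h).symm rfl⟩, by rintro ⟨x, rfl⟩; simp⟩)
    rw [walk, ← hA', ← hB']
    simp only [Matrix.mul_assoc]
  · simp only [ha, Bool.false_eq_true, false_and, if_false, Matrix.diagonal_one, Matrix.mul_one,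
      Matrix.mul_assoc, h3, h4]

end Circuits
section PhaseEstimation

variable {X A : Type*} [Fintype X] [DecidableEq X] [Fintype A] [DecidableEq A]
  {V₁ V₂ : Matrix (X × X) (X × X) ℂ} {o : X} {M : Finset X}

/-! ## Layers of Hadamard gates -/

/-- Induction by appending gates: the next qubit is still in `|0⟩`, so the branch where it is 1
contributes nothing and no sign appears. -/
theorem hadamard_list_mulVec_withZeros {L : List A} (hL : L.Nodup) (ψ : X × X → ℂ) :
    circuitOp V₁ V₂ o M (L.map Gate.hadamard) *ᵥ withZeros A ψ = fun b =>
      if ∀ r ∉ L, b.2 r = false then ψ b.1 / ((√2 : ℝ) : ℂ) ^ L.length else 0 := by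
  induction L using List.reverseRecOn with
  | nil =>
    ext b
    simp [circuitOp, withZeros, funext_iff]
  | append_singleton L q ih =>
    have hq : q ∉ L := fun h =>
      (List.nodup_append.1 hL).2.2 q h q (by simp) rfl
    have hL' : L.Nodup := (List.nodup_append.1 hL).1
    rw [List.map_append, circuitOp_append, ← Matrix.mulVec_mulVec, ih hL', List.map_singleton,
      circuitOp_singleton]
    ext b
    rw [hadamard_mulVec]
    have h1 : ¬ ∀ r ∉ L, Function.update b.2 q true r = false := fun h => by
      simpa using h q hq
    have h2 : (∀ r ∉ L, Function.update b.2 q false r = false) ↔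
        ∀ r ∉ L ++ [q], b.2 r = false := by
      refine forall_congr' fun r => ?_
      by_cases hr : r = q
      · subst hr; simp
      · simp [hr]
    simp only [if_neg h1, mul_zero, add_zero, h2, List.length_append, List.length_singleton,
      pow_succ, ← div_div]
    split_ifs <;> simp

theorem hadamard_full_mulVec_withZeros {L : List A} (hL : L.Nodup) (hall : ∀ q, q ∈ L)
    (ψ : X × X → ℂ) : circuitOp V₁ V₂ o M (L.map Gate.hadamard) *ᵥ withZeros A ψ = fun b =>
      ψ b.1 / ((√2 : ℝ) : ℂ) ^ L.length := by
  rw [hadamard_list_mulVec_withZeros hL]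
  ext b
  rw [if_pos fun r hr => absurd (hall r) hr]

omit [Fintype A] [DecidableEq A] in
theorem circuitInv_map_hadamard (L : List A) :
    circuitInv (L.map Gate.hadamard) = L.reverse.map Gate.hadamard := by
  rw [circuitInv, ← List.map_reverse, List.map_map]
  rfl

theorem hadamard_full_conjTranspose_mulVec_withZeros {L : List A} (hL : L.Nodup)
    (hall : ∀ q, q ∈ L) (ψ : X × X → ℂ) :
    (circuitOp V₁ V₂ o M (L.map Gate.hadamard))ᴴ *ᵥ withZeros A ψ = fun b =>
      ψ b.1 / ((√2 : ℝ) : ℂ) ^ L.length := by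
  rw [← circuitOp_inv, circuitInv_map_hadamard,
    hadamard_full_mulVec_withZeros (List.nodup_reverse.2 hL) (by simpa using hall),
    List.length_reverse]

/-- The zero row of the layer is the conjugate of the zero column of its adjoint, which is again a
layer of Hadamard gates, in reverse order. -/
theorem hadamard_full_mulVec_apply_zero {L : List A} (hL : L.Nodup) (hall : ∀ q, q ∈ L)
    (Ψ : (X × X) × (A → Bool) → ℂ) (p : X × X) :
    (circuitOp V₁ V₂ o M (L.map Gate.hadamard) *ᵥ Ψ) (p, fun _ => false) =
      (∑ a, Ψ (p, a)) / ((√2 : ℝ) : ℂ) ^ L.length := by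
  set H := circuitOp V₁ V₂ o M (L.map Gate.hadamard) with hH
  have h1 : ∀ b, H (p, fun _ => false) b =
      if p = b.1 then 1 / ((√2 : ℝ) : ℂ) ^ L.length else 0 := fun b => by
    have h2 : withZeros A (Pi.single p (1 : ℂ)) = Pi.single (p, fun _ => false) 1 := by
      ext ⟨p', a⟩
      simp only [withZeros, Pi.single_apply, Prod.mk.injEq]
      split_ifs <;> simp_all
    have h3 := congrFun (hadamard_full_conjTranspose_mulVec_withZeros (V₁ := V₁) (V₂ := V₂)
      (o := o) (M := M) hL hall (Pi.single p 1)) b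
    rw [h2, Matrix.mulVec_single_one] at h3
    have h4 : star (H (p, fun _ => false) b) = _ := h3
    rw [← star_star (H (p, fun _ => false) b), h4]
    simp only [Pi.single_apply, eq_comm (a := b.1)]
    split_ifs <;> simp
  simp only [Matrix.mulVec, dotProduct, h1]
  rw [Fintype.sum_prod_type, Finset.sum_eq_single p (fun z _ hz => by simp [hz.symm]) (by simp),
    Finset.sum_div]
  refine Finset.sum_congr rfl fun a _ => ?_
  rw [if_pos rfl]
  ring

/-! ## Phase estimation -/

/-- All blocks are powers of one `W`, so exponents add and the order of the gates is immaterial. -/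
theorem circuitOp_flatMap_pow {ι : Type*} {W : Matrix (X × X) (X × X) ℂ}
    (c : ι → List (Gate A)) (e : ι → (A → Bool) → ℕ)
    (h : ∀ x, circuitOp V₁ V₂ o M (c x) = Matrix.blockDiagonal fun a => W ^ e x a) (l : List ι) :
    circuitOp V₁ V₂ o M (l.flatMap c) =
      Matrix.blockDiagonal fun a => W ^ (l.map fun x => e x a).sum := by
  induction l with
  | nil =>
    simp only [List.flatMap_nil, circuitOp, List.map_nil, List.sum_nil, pow_zero]
    exact Matrix.blockDiagonal_one.symm
  | cons x l ih =>
    rw [List.flatMap_cons, circuitOp_append, ih, h, ← Matrix.blockDiagonal_mul]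
    congr 1
    ext1 a
    rw [List.map_cons, List.sum_cons, add_comm, pow_add]

/-- The number of walk steps that `ctrlPowers` makes on the branch `a`. -/
def walkSteps {k s : ℕ} (a : Fin k × Fin s → Bool) : ℕ :=
  ∑ q : Fin k × Fin s, if a q = true then 2 ^ q.2.val else 0

variable {P : Matrix X X ℝ} {π : X → ℝ}

theorem circuitOp_ctrlPowers (h₁ : IsUpdateA P o V₁) (h₂ : IsUpdateB P π o V₂) (k s : ℕ) :
    circuitOp V₁ V₂ o M (ctrlPowers k s) =
      Matrix.blockDiagonal fun a => walk P π ^ walkSteps a := by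
  have h3 : ∀ q : Fin k × Fin s, circuitOp V₁ V₂ o M (ctrlWalk q) =
      Matrix.blockDiagonal fun a => walk P π ^ (if a q = true then 1 else 0) := fun q => by
    rw [circuitOp_ctrlWalk h₁ h₂, controlled_eq_blockDiagonal]
    congr 1
    ext1 a
    split_ifs <;> simp
  have h4 : ∀ q : Fin k × Fin s,
      circuitOp V₁ V₂ o M (List.replicate (2 ^ q.2.val) (ctrlWalk q)).flatten =
        Matrix.blockDiagonal fun a => walk P π ^ (if a q = true then 2 ^ q.2.val else 0) := by
    intro q
    -- The repeated walk is a `flatMap` over a list of `2 ^ j` units.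
    have := circuitOp_flatMap_pow (V₁ := V₁) (V₂ := V₂) (o := o) (M := M)
      (fun _ : Unit => ctrlWalk q)
      (fun _ a => if a q = true then 1 else 0) (fun _ => h3 q) (List.replicate (2 ^ q.2.val) ())
    rw [List.flatMap, List.map_replicate] at this
    rw [this]
    congr 1
    ext1 a
    simp
  rw [ctrlPowers, circuitOp_flatMap_pow _ _ fun i =>
    circuitOp_flatMap_pow _ _ (fun j => h4 (i, j)) (List.finRange s)]
  congr 1
  ext1 a
  rw [walkSteps, Fintype.sum_prod_type]
  simp only [← List.ofFn_eq_map, List.sum_ofFn]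

/-- The list of all the qubits. -/
def qubitList (k s : ℕ) : List (Fin k × Fin s) := List.finRange k ×ˢ List.finRange s

theorem hadamards_eq (k s : ℕ) : hadamards k s = (qubitList k s).map Gate.hadamard := by
  simp [hadamards, qubitList, SProd.sprod, List.product, List.map_flatMap, Function.comp_def]

theorem nodup_qubitList (k s : ℕ) : (qubitList k s).Nodup :=
  (List.nodup_finRange k).product (List.nodup_finRange s)

theorem mem_qubitList {k s : ℕ} (q : Fin k × Fin s) : q ∈ qubitList k s :=
  List.pair_mem_product.2 ⟨List.mem_finRange q.1, List.mem_finRange q.2⟩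

theorem length_qubitList (k s : ℕ) : (qubitList k s).length = k * s := by
  simp [qubitList, List.length_product]

theorem sqrt_two_pow_mul_self (n : ℕ) :
    ((√2 : ℝ) : ℂ) ^ n * ((√2 : ℝ) : ℂ) ^ n = 2 ^ n := by
  rw [← mul_pow, sqrt_mul_sqrt_ofReal (by norm_num)]; norm_num

/-- Expanding the product over all qubits, a choice of one summand per factor is an ancilla string
`a`. -/
theorem phaseKernel_pow_eq_sum (k s : ℕ) :
    phaseKernel s ^ k = Polynomial.C ((1 / 2) ^ (k * s)) *
      ∑ a : Fin k × Fin s → Bool, Polynomial.X ^ walkSteps a := by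
  have h1 : phaseKernel s ^ k = ∏ q : Fin k × Fin s, ∑ c : Bool,
      Polynomial.C (1 / 2) * Polynomial.X ^ (if c = true then 2 ^ q.2.val else 0) := by
    rw [Fintype.prod_prod_type]
    simp only [Finset.prod_const, Finset.card_univ, Fintype.card_fin]
    rw [phaseKernel, ← Fin.prod_univ_eq_prod_range
      (fun j => Polynomial.C (1 / 2 : ℂ) * (1 + Polynomial.X ^ 2 ^ j))]
    congr 1
    refine Finset.prod_congr rfl fun j _ => ?_
    rw [Fintype.sum_bool]
    simp
    ring
  rw [h1, Fintype.prod_sum, Finset.mul_sum]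
  refine Finset.sum_congr rfl fun a _ => ?_
  rw [Finset.prod_mul_distrib, Finset.prod_const, Finset.card_univ, Fintype.card_prod,
    Fintype.card_fin, Fintype.card_fin, Finset.prod_pow_eq_pow_sum, map_pow, walkSteps]

/-- The first Hadamard layer weights all strings equally, the second one sums over them; the two
normalizations `√2 ^ (k * s)` combine to `2 ^ (k * s)`. No other component of the state is needed.
-/
theorem phaseEstimation_apply_zero (h₁ : IsUpdateA P o V₁) (h₂ : IsUpdateB P π o V₂) (k s : ℕ)
    (ψ : X × X → ℂ) (p : X × X) :
    (circuitOp V₁ V₂ o M (phaseEstimation k s) *ᵥ withZeros _ ψ) (p, fun _ => false) =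
      (Polynomial.aeval (walk P π) (phaseKernel s ^ k) *ᵥ ψ) p := by
  rw [phaseEstimation, circuitOp_append, circuitOp_append, ← Matrix.mulVec_mulVec,
    ← Matrix.mulVec_mulVec, hadamards_eq,
    hadamard_full_mulVec_withZeros (nodup_qubitList k s) mem_qubitList,
    hadamard_full_mulVec_apply_zero (nodup_qubitList k s) mem_qubitList, length_qubitList,
    circuitOp_ctrlPowers h₁ h₂, phaseKernel_pow_eq_sum, map_mul, Polynomial.aeval_C,
    ← Algebra.smul_def, map_sum, Matrix.smul_mulVec, Matrix.sum_mulVec, Pi.smul_apply,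
    Finset.sum_apply, smul_eq_mul, Finset.mul_sum, Finset.sum_div]
  refine Finset.sum_congr rfl fun a _ => ?_
  rw [blockDiagonal_mulVec_apply]
  have h3 : (fun p => ψ p / ((√2 : ℝ) : ℂ) ^ (k * s)) = (((√2 : ℝ) : ℂ) ^ (k * s))⁻¹ • ψ := by
    ext p
    simp [div_eq_inv_mul]
  simp only [h3]
  rw [Matrix.mulVec_smul, Pi.smul_apply, smul_eq_mul, map_pow, Polynomial.aeval_X, div_eq_mul_inv,
    mul_right_comm, ← mul_inv, sqrt_two_pow_mul_self, one_div, inv_pow]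

/-- Every branch applies a power of `W`, which fixes `ψ`. The uniform superposition is also `H†` of
the zero string, so the second layer undoes the first by `H H† = 1`. -/
theorem phaseEstimation_mulVec_fixed (h₁ : IsUpdateA P o V₁) (h₂ : IsUpdateB P π o V₂) (k s : ℕ)
    {ψ : X × X → ℂ} (hψ : walk P π *ᵥ ψ = ψ) :
    circuitOp V₁ V₂ o M (phaseEstimation k s) *ᵥ withZeros _ ψ = withZeros _ ψ := by
  have hpow : ∀ n, walk P π ^ n *ᵥ ψ = ψ := fun n => by
    induction n with
    | zero => simp
    | succ n ih => rw [pow_succ', ← Matrix.mulVec_mulVec, ih, hψ]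
  have h3 : circuitOp V₁ V₂ o M (ctrlPowers k s) *ᵥ
      (fun b => ψ b.1 / ((√2 : ℝ) : ℂ) ^ (k * s)) = fun b => ψ b.1 / ((√2 : ℝ) : ℂ) ^ (k * s) := by
    ext b
    have h4 : (fun p => ψ p / ((√2 : ℝ) : ℂ) ^ (k * s)) = (((√2 : ℝ) : ℂ) ^ (k * s))⁻¹ • ψ := by
      ext p
      simp [div_eq_inv_mul]
    rw [circuitOp_ctrlPowers h₁ h₂, blockDiagonal_mulVec_apply]
    simp only [h4]
    rw [Matrix.mulVec_smul, hpow]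
    simp [div_eq_inv_mul]
  have h5 := circuitOp_isometry (o := o) (M := M) h₁.1 h₂.1 ((qubitList k s).map Gate.hadamard)
  rw [phaseEstimation, circuitOp_append, circuitOp_append, ← Matrix.mulVec_mulVec,
    ← Matrix.mulVec_mulVec, hadamards_eq,
    hadamard_full_mulVec_withZeros (nodup_qubitList k s) mem_qubitList, length_qubitList, h3,
    ← length_qubitList, ← hadamard_full_conjTranspose_mulVec_withZeros (V₁ := V₁) (V₂ := V₂)
      (o := o) (M := M) (nodup_qubitList k s) mem_qubitList, Matrix.mulVec_mulVec,
    mul_eq_one_comm.1 h5, Matrix.one_mulVec]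

/-! ## The approximate reflection -/

theorem zeroRef_mulVec (Φ : (X × X) × (A → Bool) → ℂ) :
    (Gate.zeroRef (A := A)).op V₁ V₂ o M *ᵥ Φ =
      (2 : ℂ) • withZeros A (fun p => Φ (p, fun _ => false)) - Φ := by
  ext b
  simp only [Gate.op, Matrix.mulVec_diagonal, Pi.sub_apply, Pi.smul_apply, withZeros, smul_eq_mul]
  split_ifs with h
  · have : Φ (b.1, fun _ => false) = Φ b := by rw [← h]
    rw [this]; ring
  · ring

omit [DecidableEq X] in
theorem norm_withZeros (ψ : X × X → ℂ) :
    ‖WithLp.toLp 2 (withZeros A ψ)‖ = ‖WithLp.toLp 2 ψ‖ := by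
  have h : ‖WithLp.toLp 2 (withZeros A ψ)‖ ^ 2 = ‖WithLp.toLp 2 ψ‖ ^ 2 := by
    rw [norm_toLp_sq, norm_toLp_sq, Fintype.sum_prod_type]
    refine Finset.sum_congr rfl fun p _ => ?_
    rw [Finset.sum_eq_single (fun _ => false) (fun z _ hz => by simp [withZeros, hz]) (by simp)]
    simp [withZeros]
  exact (sq_eq_sq₀ (norm_nonneg _) (norm_nonneg _)).1 h

theorem circuitOp_approxReflection (k s : ℕ) :
    circuitOp V₁ V₂ o M (approxReflection k s) =
      (circuitOp V₁ V₂ o M (phaseEstimation k s))ᴴ * (Gate.zeroRef.op V₁ V₂ o M *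
        circuitOp V₁ V₂ o M (phaseEstimation k s)) := by
  rw [approxReflection, circuitOp_append, circuitOp_append, circuitOp_inv, circuitOp_singleton]

/-- In `U† (2 Π₀ - 1) U + 1` the identities cancel, so the deviation from `-1` is exactly the zero
outcome. -/
theorem approxReflection_mulVec_add (h₁ : IsUpdateA P o V₁) (h₂ : IsUpdateB P π o V₂) (k s : ℕ)
    (ψ : X × X → ℂ) :
    circuitOp V₁ V₂ o M (approxReflection k s) *ᵥ withZeros _ ψ + withZeros _ ψ =
      (2 : ℂ) • ((circuitOp V₁ V₂ o M (phaseEstimation k s))ᴴ *ᵥ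
        withZeros _ (Polynomial.aeval (walk P π) (phaseKernel s ^ k) *ᵥ ψ)) := by
  rw [circuitOp_approxReflection, ← Matrix.mulVec_mulVec, ← Matrix.mulVec_mulVec, zeroRef_mulVec,
    Matrix.mulVec_sub, Matrix.mulVec_mulVec (withZeros _ ψ),
    circuitOp_isometry h₁.1 h₂.1, Matrix.one_mulVec, sub_add_cancel, Matrix.mulVec_smul]
  simp only [phaseEstimation_apply_zero h₁ h₂]

theorem norm_approxReflection_mulVec_add (h₁ : IsUpdateA P o V₁) (h₂ : IsUpdateB P π o V₂)
    (k s : ℕ) (ψ : X × X → ℂ) :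
    ‖WithLp.toLp 2 (circuitOp V₁ V₂ o M (approxReflection k s) *ᵥ withZeros _ ψ +
      withZeros _ ψ)‖ =
      2 * ‖WithLp.toLp 2 (Polynomial.aeval (walk P π) (phaseKernel s ^ k) *ᵥ ψ)‖ := by
  have h := mul_eq_one_comm.1 (circuitOp_isometry (o := o) (M := M) h₁.1 h₂.1 (phaseEstimation k s))
  rw [approxReflection_mulVec_add h₁ h₂, WithLp.toLp_smul, norm_smul, Complex.norm_ofNat,
    norm_toLp_mulVec (by rw [Matrix.conjTranspose_conjTranspose]; exact h), norm_withZeros]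

theorem approxReflection_mulVec_fixed (h₁ : IsUpdateA P o V₁) (h₂ : IsUpdateB P π o V₂) (k s : ℕ)
    {ψ : X × X → ℂ} (hψ : walk P π *ᵥ ψ = ψ) :
    circuitOp V₁ V₂ o M (approxReflection k s) *ᵥ withZeros _ ψ = withZeros _ ψ := by
  have h3 := phaseEstimation_mulVec_fixed (M := M) h₁ h₂ k s hψ
  have h4 : Gate.zeroRef.op V₁ V₂ o M *ᵥ withZeros (Fin k × Fin s) ψ = withZeros _ ψ := by
    rw [zeroRef_mulVec]
    simp only [withZeros, if_true]
    rw [show (fun p => ψ p) = ψ from rfl, two_smul]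
    exact add_sub_cancel_right _ _
  rw [circuitOp_approxReflection, ← Matrix.mulVec_mulVec, ← Matrix.mulVec_mulVec, h3, h4]
  nth_rw 1 [← h3]
  rw [Matrix.mulVec_mulVec, circuitOp_isometry h₁.1 h₂.1, Matrix.one_mulVec]

end PhaseEstimation
/-! ## Accuracy of the approximate reflection -/

theorem two_pow_phaseBits {θ : ℝ} (h0 : 0 < θ) (h1 : θ ≤ Real.pi / 2) :
    2 * Real.pi / θ ≤ 2 ^ phaseBits (2 * θ) ∧ (2 : ℝ) ^ phaseBits (2 * θ) ≤ 4 * Real.pi / θ := by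
  have hpi := Real.pi_pos
  have h2 : 4 * Real.pi / (2 * θ) = 2 * Real.pi / θ := by field_simp; norm_num
  have h3 : 1 ≤ 2 * Real.pi / θ := by rw [le_div_iff₀ h0]; linarith
  have h4 : 0 < 2 * Real.pi / θ := by linarith
  -- The natural ceiling truncates at 0, so nonnegativity is needed for the upper bound, where
  -- rounding costs a factor 2.
  have hlog : 0 ≤ Real.logb 2 (2 * Real.pi / θ) := Real.logb_nonneg (by norm_num) h3
  rw [phaseBits, h2, ← Real.rpow_natCast]
  constructor
  · calc 2 * Real.pi / θ = (2 : ℝ) ^ Real.logb 2 (2 * Real.pi / θ) :=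
          (Real.rpow_logb (by norm_num) (by norm_num) h4).symm
      _ ≤ _ := Real.rpow_le_rpow_of_exponent_le (by norm_num) (Nat.le_ceil _)
  · calc (2 : ℝ) ^ ((⌈Real.logb 2 (2 * Real.pi / θ)⌉₊ : ℕ) : ℝ)
        ≤ (2 : ℝ) ^ (Real.logb 2 (2 * Real.pi / θ) + 1) :=
          Real.rpow_le_rpow_of_exponent_le (by norm_num) (Nat.ceil_lt_add_one hlog).le
      _ = 4 * Real.pi / θ := by
          rw [Real.rpow_add (by norm_num), Real.rpow_logb (by norm_num) (by norm_num) h4,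
            Real.rpow_one]
          ring

section Search

variable {X : Type*} [Fintype X] [DecidableEq X] {P : Matrix X X ℝ} {π : X → ℝ}
  {V₁ V₂ : Matrix (X × X) (X × X) ℂ} {o : X} {M : Finset X}

theorem norm_approxReflection_le [Nontrivial X] (hP : IsErgodicChain P)
    (hπ : IsStationaryDist P π) (hr : IsReversibleChain P π) (h₁ : IsUpdateA P o V₁)
    (h₂ : IsUpdateB P π o V₂) {k s : ℕ} (hk : 1 ≤ k) (hs : s = phaseBits (phaseGap P π))
    {ψ : X × X → ℂ} (hψ : ψ ∈ busySpace P π) :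
    ‖WithLp.toLp 2 (circuitOp V₁ V₂ o M (approxReflection k s) *ᵥ withZeros _ ψ +
      withZeros _ ψ)‖ ≤ (1 / 2 : ℝ) ^ k * ‖WithLp.toLp 2 ψ‖ := by
  obtain ⟨θ, hΔ, h0, h1, -, hθ⟩ := phaseGap_spec hP hπ hr
  rw [hΔ] at hs
  have h2 := norm_phaseKernel_pow_mulVec_le hP hπ hr h0 h1 hθ
    (hs ▸ (two_pow_phaseBits h0 h1).1) k hψ
  rw [norm_approxReflection_mulVec_add h₁ h₂]
  have h3 : (1 / 4 : ℝ) ^ k = (1 / 2) ^ k * (1 / 2) ^ k := by rw [← mul_pow]; norm_num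
  -- Here `k ≥ 1` enters: one factor `2⁻ᵏ` absorbs the 2 of the reflection.
  have h4 : (1 / 2 : ℝ) ^ k ≤ 1 / 2 := by
    simpa using pow_le_pow_of_le_one (by norm_num : (0 : ℝ) ≤ 1 / 2) (by norm_num) hk
  calc _ ≤ 2 * ((1 / 4) ^ k * ‖WithLp.toLp 2 ψ‖) := by gcongr
    _ = (1 / 2) ^ k * ‖WithLp.toLp 2 ψ‖ * (2 * (1 / 2) ^ k) := by rw [h3]; ring
    _ ≤ (1 / 2) ^ k * ‖WithLp.toLp 2 ψ‖ * 1 := by gcongr; linarith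
    _ = _ := mul_one _

/-! ## The search -/

/-- The vector with amplitudes `a √(π x)` at marked and `b √(π x)` at unmarked `x`. -/
noncomputable def amp (π : X → ℝ) (M : Finset X) (a b : ℝ) : X → ℂ :=
  fun x => (((if x ∈ M then a else b) * √(π x) : ℝ) : ℂ)

theorem sum_ite_mul_dist (hπ : IsStationaryDist P π) (a b : ℝ) :
    ∑ x, (if x ∈ M then a else b) * π x = (∑ x ∈ M, π x) * a + (1 - ∑ x ∈ M, π x) * b := by
  have h1 : ∀ x, (if x ∈ M then a else b) * π x = b * π x + (a - b) * (if x ∈ M then π x else 0) :=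
    fun x => by split_ifs <;> ring
  simp only [h1, Finset.sum_add_distrib, ← Finset.mul_sum, hπ.sum_eq_one]
  rw [Finset.sum_ite_mem, Finset.univ_inter]
  ring

theorem norm_amp_sq (hπ : IsStationaryDist P π) (a b : ℝ) :
    ‖WithLp.toLp 2 (amp π M a b)‖ ^ 2 =
      (∑ x ∈ M, π x) * a ^ 2 + (1 - ∑ x ∈ M, π x) * b ^ 2 := by
  rw [norm_toLp_sq, ← sum_ite_mul_dist hπ]
  refine Finset.sum_congr rfl fun x _ => ?_
  rw [amp, Complex.norm_real, Real.norm_eq_abs, sq_abs, mul_pow, Real.sq_sqrt (hπ.nonneg x)]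
  split_ifs <;> rfl

theorem sqrtDist_dotProduct_amp (hπ : IsStationaryDist P π) (a b : ℝ) :
    sqrtDist π ⬝ᵥ amp π M a b =
      (((∑ x ∈ M, π x) * a + (1 - ∑ x ∈ M, π x) * b : ℝ) : ℂ) := by
  rw [← sum_ite_mul_dist hπ, dotProduct, Complex.ofReal_sum]
  refine Finset.sum_congr rfl fun x _ => ?_
  simp only [sqrtDist, amp]
  rw [← Complex.ofReal_mul]
  congr 1
  linear_combination (if x ∈ M then a else b) * Real.mul_self_sqrt (hπ.nonneg x)

omit [Fintype X] in
theorem amp_add (a b c d : ℝ) : amp π M a b + amp π M c d = amp π M (a + c) (b + d) := by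
  ext x
  simp only [amp, Pi.add_apply, ← Complex.ofReal_add]
  congr 1
  split_ifs <;> ring

omit [Fintype X] in
theorem amp_self (a : ℝ) : amp π M a a = (a : ℂ) • sqrtDist π := by
  ext x
  simp [amp, sqrtDist]

theorem check_mulVec {A : Type*} [Fintype A] [DecidableEq A] (a b : ℝ) :
    (Gate.check (A := A)).op V₁ V₂ o M *ᵥ withZeros A (matA P *ᵥ amp π M a b) =
      withZeros A (matA P *ᵥ amp π M (-a) b) := by
  ext c
  simp only [Gate.op, Matrix.mulVec_diagonal, withZeros, matA_mulVec_apply, amp]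
  split_ifs <;> push_cast <;> ring

omit [Fintype X] [DecidableEq X] in
theorem withZeros_add {A : Type*} [Fintype A] [DecidableEq A] (φ ψ : X × X → ℂ) :
    withZeros A (φ + ψ) = withZeros A φ + withZeros A ψ := by
  ext b
  simp only [withZeros, Pi.add_apply]
  split_ifs <;> simp

theorem matA_mulVec_mem_busySpace {v : X → ℂ} (hv : v ∈ orthSqrt π) :
    matA P *ᵥ v ∈ busySpace P π :=
  mem_busySpace.2 ⟨v, hv, 0, zero_mem _, by rw [Matrix.mulVec_zero, add_zero]⟩

theorem norm_matA_mulVec (hP : IsErgodicChain P) (v : X → ℂ) :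
    ‖WithLp.toLp 2 (matA P *ᵥ v)‖ = ‖WithLp.toLp 2 v‖ :=
  norm_toLp_mulVec (matA_isometry hP.stochastic) v

theorem walk_mulVec_smul_piState (hP : IsErgodicChain P) (hπ : IsStationaryDist P π)
    (hr : IsReversibleChain P π) (c : ℂ) :
    walk P π *ᵥ (c • piState P π) = c • piState P π := by
  rw [Matrix.mulVec_smul, walk_mulVec_piState hP hπ hr]

/-- The approximate reflection maps a unit vector of the search plane close to its mirror image. -/
theorem norm_approxReflection_amp_sub_le [Nontrivial X] (hP : IsErgodicChain P)
    (hπ : IsStationaryDist P π) (hr : IsReversibleChain P π) (h₁ : IsUpdateA P o V₁)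
    (h₂ : IsUpdateB P π o V₂) {k s : ℕ} (hk : 1 ≤ k) (hs : s = phaseBits (phaseGap P π))
    {ε a b : ℝ} (hε : ε = ∑ x ∈ M, π x) (hab : ε * a ^ 2 + (1 - ε) * b ^ 2 = 1) :
    ‖WithLp.toLp 2 (circuitOp V₁ V₂ o M (approxReflection k s) *ᵥ
        withZeros _ (matA P *ᵥ amp π M a b) -
      withZeros _ (matA P *ᵥ amp π M (2 * (ε * a + (1 - ε) * b) - a)
        (2 * (ε * a + (1 - ε) * b) - b)))‖ ≤ (1 / 2 : ℝ) ^ k := by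
  -- `m` is the overlap with `|π⟩`. The vector is `m |π⟩ + χ`, its mirror image is `m |π⟩ - χ`, and
  -- as `R(P)` fixes `|π⟩` the error is `Rχ + χ`.
  set m := ε * a + (1 - ε) * b with hm
  set χ := matA P *ᵥ amp π M (a - m) (b - m) with hχ
  have h3 : matA P *ᵥ amp π M a b = (m : ℂ) • piState P π + χ := by
    rw [hχ, ← matA_mulVec_sqrtDist, ← Matrix.mulVec_smul, ← amp_self (M := M), ← Matrix.mulVec_add,
      amp_add]
    congr 2 <;> ring
  have h4 : (m : ℂ) • piState P π = matA P *ᵥ amp π M (2 * m - a) (2 * m - b) + χ := by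
    rw [hχ, ← matA_mulVec_sqrtDist, ← Matrix.mulVec_smul, ← amp_self (M := M), ← Matrix.mulVec_add,
      amp_add]
    congr 2 <;> ring
  have hmem : χ ∈ busySpace P π := by
    refine matA_mulVec_mem_busySpace ?_
    rw [mem_orthSqrt, sqrtDist_dotProduct_amp hπ, ← hε,
      show ε * (a - m) + (1 - ε) * (b - m) = 0 by rw [hm]; ring, Complex.ofReal_zero]
  have hnorm : ‖WithLp.toLp 2 χ‖ ≤ 1 := by
    have h5 : ‖WithLp.toLp 2 χ‖ ^ 2 ≤ 1 := by
      rw [hχ, norm_matA_mulVec hP, norm_amp_sq hπ, ← hε,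
        show ε * (a - m) ^ 2 + (1 - ε) * (b - m) ^ 2 =
          ε * a ^ 2 + (1 - ε) * b ^ 2 - m ^ 2 by rw [hm]; ring, hab]
      linarith [sq_nonneg m]
    exact (sq_le_one_iff₀ (norm_nonneg _)).1 h5
  have h5 := norm_approxReflection_le (M := M) hP hπ hr h₁ h₂ hk hs hmem
  rw [h3, withZeros_add, Matrix.mulVec_add, approxReflection_mulVec_fixed h₁ h₂ k s
    (walk_mulVec_smul_piState hP hπ hr m), h4, withZeros_add, add_right_comm, add_assoc,
    add_sub_cancel_left]
  refine (le_trans (le_of_eq ?_) h5).trans (mul_le_of_le_one_right (by positivity) hnorm)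
  rw [add_comm]

theorem circuitOp_replicate_flatten {A : Type*} [Fintype A] [DecidableEq A] (c : List (Gate A))
    (t : ℕ) : circuitOp V₁ V₂ o M (List.replicate t c).flatten = circuitOp V₁ V₂ o M c ^ t := by
  induction t with
  | zero => simp [circuitOp]
  | succ t ih => rw [List.replicate_succ, List.flatten_cons, circuitOp_append, ih, pow_succ]

theorem updA_mulVec_setupState {A : Type*} [Fintype A] [DecidableEq A] (h₁ : IsUpdateA P o V₁) :
    (Gate.updA (A := A)).op V₁ V₂ o M *ᵥ withZeros A (setupState π o) =
      withZeros A (piState P π) := by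
  have h : V₁ *ᵥ setupState π o = piState P π := by
    have h2 : setupState π o = ∑ x, ((√(π x) : ℝ) : ℂ) • Pi.single (x, o) (1 : ℂ) := by
      ext ⟨x, y⟩
      simp only [setupState, Finset.sum_apply, Pi.smul_apply, Pi.single_apply, Prod.mk.injEq,
        smul_eq_mul]
      rw [Finset.sum_eq_single x (fun z _ hz => by simp [hz.symm]) (by simp)]
      simp
    rw [h2, Matrix.mulVec_sum, piState]
    simp only [Matrix.mulVec_smul, h₁.2]
  ext b
  rw [Gate.op, Matrix.kronecker_one, blockDiagonal_mulVec_apply]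
  by_cases hb : b.2 = fun _ => false
  · simp only [withZeros, hb, if_true]
    exact congrFun h b.1
  · simp only [withZeros, hb, if_false]
    exact congrFun (Matrix.mulVec_zero V₁) b.1

theorem searchState_eq (h₁ : IsUpdateA P o V₁) (k s t : ℕ) :
    searchState π V₁ V₂ o M k s t =
      circuitOp V₁ V₂ o M (searchStep k s) ^ t *ᵥ withZeros _ (piState P π) := by
  rw [searchState, searchCircuit, circuitOp, ← Matrix.mulVec_mulVec, updA_mulVec_setupState h₁,
    circuitOp_replicate_flatten]

/-- After `t` iterations the state is close to the one that exact reflections would give. -/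
theorem exists_amp_near_searchState [Nontrivial X] (hP : IsErgodicChain P)
    (hπ : IsStationaryDist P π) (hr : IsReversibleChain P π) (h₁ : IsUpdateA P o V₁)
    (h₂ : IsUpdateB P π o V₂) {k s : ℕ} (hk : 1 ≤ k) (hs : s = phaseBits (phaseGap P π))
    {ε φ : ℝ} (hε : ε = ∑ x ∈ M, π x) (hsin : Real.sin φ ^ 2 = ε) (t : ℕ) :
    ∃ a b : ℝ, Real.sin φ * a = Real.sin ((2 * t + 1) * φ) ∧
      Real.cos φ * b = Real.cos ((2 * t + 1) * φ) ∧
      ‖WithLp.toLp 2 (searchState π V₁ V₂ o M k s t -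
        withZeros _ (matA P *ᵥ amp π M a b))‖ ≤ t * (1 / 2 : ℝ) ^ k := by
  have hcos : Real.cos φ ^ 2 = 1 - ε := by rw [← hsin, Real.cos_sq']
  rw [searchState_eq h₁]
  induction t with
  | zero =>
    refine ⟨1, 1, by simp, by simp, ?_⟩
    rw [amp_self, Complex.ofReal_one, one_smul, matA_mulVec_sqrtDist]
    simp
  | succ t ih =>
    obtain ⟨a, b, ha, hb, h⟩ := ih
    -- The check turns `α` into `-α`; the mirrored amplitudes then belong to `α + 2 φ`. The
    -- relations are kept as products because `cos φ = 0` when `ε = 1`.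
    set α := (2 * t + 1) * φ with hα
    set m := ε * -a + (1 - ε) * b with hm
    have hmc : m = Real.cos (α + φ) := by
      rw [hm, ← hsin, ← Real.cos_sq', Real.cos_add, ← ha, ← hb]; ring
    have hα' : (2 * ((t + 1 : ℕ) : ℝ) + 1) * φ = (α + φ) + φ := by rw [hα]; push_cast; ring
    have hs1 : Real.sin α = Real.sin (α + φ) * Real.cos φ - Real.cos (α + φ) * Real.sin φ := by
      rw [← Real.sin_sub, add_sub_cancel_right]
    have hc1 : Real.cos α = Real.cos (α + φ) * Real.cos φ + Real.sin (α + φ) * Real.sin φ := by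
      rw [← Real.cos_sub, add_sub_cancel_right]
    refine ⟨2 * m - -a, 2 * m - b, ?_, ?_, ?_⟩
    · rw [hα', Real.sin_add (α + φ), hmc]
      linear_combination ha + hs1
    · rw [hα', Real.cos_add (α + φ), hmc]
      linear_combination (-1 : ℝ) * hb - hc1
    · have hunit : ε * (-a) ^ 2 + (1 - ε) * b ^ 2 = 1 := by
        rw [← hcos, ← hsin]
        calc _ = (Real.sin φ * a) ^ 2 + (Real.cos φ * b) ^ 2 := by ring
          _ = 1 := by rw [ha, hb, Real.sin_sq_add_cos_sq]
      have h3 := norm_approxReflection_amp_sub_le hP hπ hr h₁ h₂ hk hs hε hunit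
      rw [← hm, ← check_mulVec (V₁ := V₁) (V₂ := V₂) (o := o), Matrix.mulVec_mulVec] at h3
      have h4 : circuitOp V₁ V₂ o M (approxReflection k s) * Gate.check.op V₁ V₂ o M =
        circuitOp V₁ V₂ o M (searchStep k s) := rfl
      rw [h4] at h3
      set G := circuitOp V₁ V₂ o M (searchStep k s) with hG
      -- The step is unitary, so earlier errors are not amplified.
      have h5 : ‖WithLp.toLp 2 (G *ᵥ (G ^ t *ᵥ withZeros _ (piState P π) -
          withZeros _ (matA P *ᵥ amp π M a b)))‖ ≤ t * (1 / 2 : ℝ) ^ k := by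
        rwa [norm_toLp_mulVec (circuitOp_isometry h₁.1 h₂.1 _)]
      rw [Matrix.mulVec_sub, Matrix.mulVec_mulVec, ← pow_succ'] at h5
      have h6 := (norm_add_le _ _).trans (add_le_add h5 h3)
      rw [← WithLp.toLp_add, sub_add_sub_cancel] at h6
      push_cast
      linarith

/-- The projection onto the marked basis states. -/
noncomputable def markedPart {A : Type*} (M : Finset X) (Ψ : (X × X) × (A → Bool) → ℂ) :
    (X × X) × (A → Bool) → ℂ := fun b => if b.1.1 ∈ M then Ψ b else 0

theorem successProb_eq (k s t : ℕ) : successProb π V₁ V₂ o M k s t =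
    ‖WithLp.toLp 2 (markedPart M (searchState π V₁ V₂ o M k s t))‖ ^ 2 := by
  rw [norm_toLp_sq, successProb]
  refine Finset.sum_congr rfl fun b _ => ?_
  rw [markedPart]
  split_ifs <;> simp

theorem norm_markedPart_le {A : Type*} [Fintype A] [DecidableEq A]
    (Ψ : (X × X) × (A → Bool) → ℂ) :
    ‖WithLp.toLp 2 (markedPart M Ψ)‖ ≤ ‖WithLp.toLp 2 Ψ‖ := by
  refine (sq_le_sq₀ (norm_nonneg _) (norm_nonneg _)).1 ?_
  rw [norm_toLp_sq, norm_toLp_sq]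
  refine Finset.sum_le_sum fun b _ => ?_
  rw [markedPart]
  split_ifs
  · exact le_rfl
  · simp

theorem markedPart_amp {A : Type*} [Fintype A] [DecidableEq A] (a b : ℝ) :
    markedPart M (withZeros A (matA P *ᵥ amp π M a b)) = withZeros A (matA P *ᵥ amp π M a 0) := by
  ext c
  simp only [markedPart, withZeros, matA_mulVec_apply, amp]
  split_ifs <;> simp

/-- Makes the failure probability `1 - p` nonnegative, so that its powers are monotone. -/
theorem successProb_le_one (hP : IsErgodicChain P) (hπ : IsStationaryDist P π)
    (h₁ : IsUpdateA P o V₁) (h₂ : V₂ ∈ Matrix.unitaryGroup (X × X) ℂ) (k s t : ℕ) :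
    successProb π V₁ V₂ o M k s t ≤ 1 := by
  have h3 : ‖WithLp.toLp 2 (searchState π V₁ V₂ o M k s t)‖ = 1 := by
    have h4 : ‖WithLp.toLp 2 (sqrtDist π)‖ ^ 2 = 1 := by
      have := norm_amp_sq (M := M) hπ 1 1
      rw [amp_self, Complex.ofReal_one, one_smul] at this
      rw [this]; ring
    rw [searchState_eq h₁,
      norm_toLp_mulVec (conjTranspose_mul_pow (circuitOp_isometry h₁.1 h₂ _) _), norm_withZeros,
      ← matA_mulVec_sqrtDist, norm_matA_mulVec hP]
    exact (pow_eq_one_iff_of_nonneg (norm_nonneg _) two_ne_zero).1 h4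
  rw [successProb_eq]
  exact pow_le_one₀ (norm_nonneg _) (h3 ▸ norm_markedPart_le _)

theorem sin_sq_sub_le_successProb [Nontrivial X] (hP : IsErgodicChain P)
    (hπ : IsStationaryDist P π) (hr : IsReversibleChain P π) (h₁ : IsUpdateA P o V₁)
    (h₂ : IsUpdateB P π o V₂) {k s : ℕ} (hk : 1 ≤ k) (hs : s = phaseBits (phaseGap P π))
    {ε φ : ℝ} (hε : ε = ∑ x ∈ M, π x) (hsin : Real.sin φ ^ 2 = ε) (t : ℕ) :
    Real.sin ((2 * t + 1) * φ) ^ 2 - 2 * (t * (1 / 2 : ℝ) ^ k) ≤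
      successProb π V₁ V₂ o M k s t := by
  obtain ⟨a, b, ha, -, h⟩ := exists_amp_near_searchState (M := M) hP hπ hr h₁ h₂ hk hs hε hsin t
  set Ψ := searchState π V₁ V₂ o M k s t with hΨ
  set Φ := withZeros (Fin k × Fin s) (matA P *ᵥ amp π M a b) with hΦ
  have h3 : ‖WithLp.toLp 2 (markedPart M Φ)‖ ^ 2 = Real.sin ((2 * t + 1) * φ) ^ 2 := by
    rw [hΦ, markedPart_amp, norm_withZeros, norm_matA_mulVec hP, norm_amp_sq hπ, ← hε, ← hsin,
      ← ha]
    ring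
  have h4 : markedPart M Φ = markedPart M Ψ - markedPart M (Ψ - Φ) := by
    ext c
    simp only [markedPart, Pi.sub_apply]
    split_ifs <;> simp
  have h5 : ‖WithLp.toLp 2 (markedPart M Φ)‖ ≤ ‖WithLp.toLp 2 (markedPart M Ψ)‖ +
      t * (1 / 2 : ℝ) ^ k := by
    rw [h4, WithLp.toLp_sub]
    exact (norm_sub_le _ _).trans (add_le_add le_rfl ((norm_markedPart_le _).trans h))
  have h6 : ‖WithLp.toLp 2 (markedPart M Φ)‖ ≤ 1 := by
    refine (sq_le_one_iff₀ (norm_nonneg _)).1 ?_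
    rw [h3]
    exact Real.sin_sq_le_one _
  rw [successProb_eq, ← h3]
  have h7 := norm_nonneg (WithLp.toLp 2 (markedPart M Φ))
  have h8 := norm_nonneg (WithLp.toLp 2 (markedPart M Ψ))
  have h9 : 0 ≤ t * (1 / 2 : ℝ) ^ k := by positivity
  set x := ‖WithLp.toLp 2 (markedPart M Φ)‖
  set y := ‖WithLp.toLp 2 (markedPart M Ψ)‖
  -- Write `d` for the error, so `x ≤ y + d` and `x ≤ 1`. If `x ≤ d`, then `x² - 2d ≤ 0`; otherwise
  -- square `x - d ≤ y`.
  rcases le_total x (t * (1 / 2 : ℝ) ^ k) with hx | hx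
  · nlinarith
  · nlinarith

end Search
/-! ## Costs -/

section Costs

variable {A : Type*} (κ : Costs)

theorem Costs.update_nonneg : 0 ≤ κ.update := κ.elementary_nonneg.trans κ.elementary_le_update

theorem circuitCost_append (c d : List (Gate A)) :
    circuitCost κ (c ++ d) = circuitCost κ c + circuitCost κ d := by
  simp [circuitCost]

theorem circuitCost_cons (g : Gate A) (c : List (Gate A)) :
    circuitCost κ (g :: c) = g.cost κ + circuitCost κ c := by
  simp [circuitCost]

theorem circuitCost_inv (c : List (Gate A)) :
    circuitCost κ (circuitInv c) = circuitCost κ c := by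
  have h : ∀ g : Gate A, g.inv.cost κ = g.cost κ := fun g => by cases g <;> rfl
  simp [circuitCost, circuitInv, Function.comp_def, h, List.sum_reverse]

theorem circuitCost_flatMap {ι : Type*} (l : List ι) (c : ι → List (Gate A)) :
    circuitCost κ (l.flatMap c) = (l.map fun i => circuitCost κ (c i)).sum := by
  induction l with
  | nil => simp [circuitCost]
  | cons i l ih => rw [List.flatMap_cons, circuitCost_append, ih, List.map_cons, List.sum_cons]

theorem circuitCost_replicate_flatten (t : ℕ) (c : List (Gate A)) :
    circuitCost κ (List.replicate t c).flatten = t * circuitCost κ c := by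
  induction t with
  | zero => simp [circuitCost]
  | succ t ih =>
    rw [List.replicate_succ, List.flatten_cons, circuitCost_append, ih]; push_cast; ring

theorem circuitCost_hadamards (k s : ℕ) :
    circuitCost κ (hadamards k s) = k * s * κ.elementary := by
  simp [hadamards_eq, circuitCost, Function.comp_def, Gate.cost, length_qubitList]

theorem circuitCost_ctrlPowers (k s : ℕ) : circuitCost κ (ctrlPowers k s) =
    k * ((2 ^ s - 1) * (4 * κ.update + 2 * κ.elementary)) := by
  have h1 : ∀ q : Fin k × Fin s, circuitCost κ (ctrlWalk q) = 4 * κ.update + 2 * κ.elementary :=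
    fun q => by simp [circuitCost, ctrlWalk, Gate.cost]; ring
  rw [ctrlPowers, circuitCost_flatMap]
  simp only [circuitCost_flatMap, circuitCost_replicate_flatten, h1]
  simp only [← List.ofFn_eq_map, List.sum_ofFn, ← Finset.sum_mul]
  rw [Finset.sum_const, Finset.card_univ, Fintype.card_fin, nsmul_eq_mul]
  push_cast
  rw [Fin.sum_univ_eq_sum_range (fun i => (2 : ℝ) ^ i), geom_sum_eq (by norm_num)]
  norm_num
  ring

/-- The unit is `k 2ˢ U`. A phase estimation costs at most 6 units for the walks (4 updates and 2
reflections per step) and 1 for each of its two Hadamard layers; it occurs twice, and `zeroRef` adds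
1. -/
theorem circuitCost_approxReflection_le {k s : ℕ} (hk : 1 ≤ k) :
    circuitCost κ (approxReflection k s) ≤ 17 * (k * 2 ^ s * κ.update) := by
  have hu := κ.elementary_nonneg
  have huU := κ.elementary_le_update
  have hU := κ.update_nonneg
  have hs : (s : ℝ) ≤ 2 ^ s := by exact_mod_cast Nat.lt_two_pow_self.le
  have hk' : (1 : ℝ) ≤ k := by exact_mod_cast hk
  have h2 : (1 : ℝ) ≤ 2 ^ s := one_le_pow₀ (by norm_num)
  have h3 : (k : ℝ) * s * κ.elementary ≤ k * 2 ^ s * κ.update := by gcongr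
  have h4 : (k : ℝ) * ((2 ^ s - 1) * (4 * κ.update + 2 * κ.elementary)) ≤
      6 * (k * 2 ^ s * κ.update) := by
    calc (k : ℝ) * ((2 ^ s - 1) * (4 * κ.update + 2 * κ.elementary))
        ≤ k * (2 ^ s * (4 * κ.update + 2 * κ.update)) := by gcongr; linarith
      _ = _ := by ring
  have h5 : κ.elementary ≤ k * 2 ^ s * κ.update :=
    huU.trans (le_mul_of_one_le_left hU (one_le_mul_of_one_le_of_one_le hk' h2))
  have h6 : circuitCost κ ([.zeroRef] : List (Gate (Fin k × Fin s))) = κ.elementary := by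
    simp [circuitCost, Gate.cost]
  rw [approxReflection, circuitCost_append, circuitCost_append, circuitCost_inv, h6,
    phaseEstimation, circuitCost_append, circuitCost_append, circuitCost_hadamards,
    circuitCost_ctrlPowers]
  linarith

theorem searchCost_le {k s : ℕ} (hk : 1 ≤ k) (t : ℕ) : searchCost κ k s t ≤
    κ.setup + κ.update + κ.checking + t * (κ.checking + 17 * (k * 2 ^ s * κ.update)) := by
  have h : circuitCost κ (searchCircuit k s t) =
      κ.update + t * (κ.checking + circuitCost κ (approxReflection k s)) := by
    rw [searchCircuit, circuitCost_cons, circuitCost_replicate_flatten, searchStep,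
      circuitCost_cons]
    rfl
  rw [searchCost, h]
  have h2 := mul_le_mul_of_nonneg_left
    (add_le_add_right (circuitCost_approxReflection_le κ (s := s) hk) κ.checking)
    (Nat.cast_nonneg (α := ℝ) t)
  linarith

end Costs

/-! ## Choice of the parameters -/

/-- The number of iterations. -/
noncomputable def searchIterations (ε : ℝ) : ℕ :=
  if 1 / 2 ≤ ε then 0 else ⌊Real.pi / (4 * Real.arcsin √ε)⌋₊

/-- The number of runs of phase estimation. -/
noncomputable def searchRepetitions (η ε : ℝ) : ℕ := ⌈Real.logb 2 (2 / (√ε * η))⌉₊ + 1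

theorem le_arcsin {x : ℝ} (h0 : 0 ≤ x) (h1 : x ≤ 1) : x ≤ Real.arcsin x := by
  have := Real.sin_le (Real.arcsin_nonneg.2 h0)
  rwa [Real.sin_arcsin (by linarith) h1] at this

theorem searchIterations_le {ε : ℝ} (h0 : 0 < ε) (h1 : ε ≤ 1) :
    (searchIterations ε : ℝ) ≤ 1 / √ε := by
  have hs : 0 < √ε := Real.sqrt_pos.2 h0
  rw [searchIterations]
  split_ifs
  · simp
  · have hle := le_arcsin hs.le (Real.sqrt_le_one.2 h1)
    refine (Nat.floor_le (div_nonneg Real.pi_pos.le (by linarith))).trans ?_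
    rw [div_le_div_iff₀ (by linarith) hs]
    nlinarith [Real.pi_le_four]

theorem max_le_sin_sq {ε : ℝ} (h0 : 0 < ε) (h1 : ε ≤ 1) :
    max ε (1 - ε) ≤ Real.sin ((2 * searchIterations ε + 1) * Real.arcsin √ε) ^ 2 := by
  have hs : 0 < √ε := Real.sqrt_pos.2 h0
  have hsin : Real.sin (Real.arcsin √ε) = √ε :=
    Real.sin_arcsin (by linarith) (Real.sqrt_le_one.2 h1)
  rw [searchIterations]
  split_ifs with h
  -- For `ε ≥ 1/2` no iteration is made: observing `|π⟩` already succeeds with probability `ε`.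
  · rw [Nat.cast_zero, mul_zero, zero_add, one_mul, hsin, Real.sq_sqrt h0.le]
    exact max_le le_rfl (by linarith)
  · set φ := Real.arcsin √ε with hφ
    have hφ0 : 0 < φ := Real.arcsin_pos.2 hs
    have hφ2 : φ ≤ Real.pi / 2 := Real.arcsin_le_pi_div_two _
    have ht1 := Nat.floor_le (div_nonneg Real.pi_pos.le (by linarith : 0 ≤ 4 * φ))
    have ht2 := Nat.lt_floor_add_one (Real.pi / (4 * φ))
    set t : ℝ := (⌊Real.pi / (4 * φ)⌋₊ : ℝ)
    rw [le_div_iff₀ (by linarith)] at ht1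
    rw [div_lt_iff₀ (by linarith)] at ht2
    -- The choice of the floor leaves the final angle within `φ` of `π/2`, so the failure
    -- probability `sin² y` is at most `sin² φ = ε`.
    set y := Real.pi / 2 - (2 * t + 1) * φ with hy
    have hy1 : y ≤ φ := by rw [hy]; nlinarith
    have hy2 : -φ ≤ y := by rw [hy]; nlinarith
    have hle : Real.sin y ^ 2 ≤ ε := by
      rw [← Real.sq_sqrt h0.le, ← hsin]
      refine sq_le_sq' ?_ ?_
      · rw [← Real.sin_neg]
        exact Real.sin_le_sin_of_le_of_le_pi_div_two (by linarith) (by linarith) hy2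
      · exact Real.sin_le_sin_of_le_of_le_pi_div_two (by linarith) hφ2 hy1
    have hc : Real.sin y = Real.cos ((2 * t + 1) * φ) := Real.sin_pi_div_two_sub _
    rw [hc, Real.cos_sq'] at hle
    push Not at h
    rw [max_eq_right (by linarith)]
    linarith

theorem one_le_two_div {η ε : ℝ} (hη : 0 < η) (hη1 : η ≤ 1) (h0 : 0 < ε) (h1 : ε ≤ 1) :
    1 ≤ 2 / (√ε * η) := by
  have hs : 0 < √ε := Real.sqrt_pos.2 h0
  rw [le_div_iff₀ (by positivity), one_mul]
  have := mul_le_mul (Real.sqrt_le_one.2 h1) hη1 hη.le zero_le_one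
  linarith

theorem searchIterations_mul_le {η ε : ℝ} (hη : 0 < η) (h0 : 0 < ε) (h1 : ε ≤ 1) :
    2 * (searchIterations ε * (1 / 2 : ℝ) ^ searchRepetitions η ε) ≤ η := by
  have hs : 0 < √ε := Real.sqrt_pos.2 h0
  have hk : 2 / (√ε * η) ≤ (2 : ℝ) ^ searchRepetitions η ε := by
    calc 2 / (√ε * η) = (2 : ℝ) ^ Real.logb 2 (2 / (√ε * η)) :=
          (Real.rpow_logb (by norm_num) (by norm_num) (by positivity)).symm
      _ ≤ (2 : ℝ) ^ ((searchRepetitions η ε : ℕ) : ℝ) := by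
          refine Real.rpow_le_rpow_of_exponent_le (by norm_num) ((Nat.le_ceil _).trans ?_)
          -- The additional run only guarantees `k ≥ 1`.
          exact_mod_cast Nat.le_succ _
      _ = _ := Real.rpow_natCast _ _
  have hk2 : (1 / 2 : ℝ) ^ searchRepetitions η ε ≤ √ε * η / 2 := by
    rw [one_div, inv_pow, ← inv_div]
    exact inv_anti₀ (by positivity) hk
  calc 2 * (searchIterations ε * (1 / 2 : ℝ) ^ searchRepetitions η ε)
      ≤ 2 * (1 / √ε * (√ε * η / 2)) := by
        gcongr
        exact searchIterations_le h0 h1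
    _ = η := by field_simp

theorem log_one_div_sqrt_nonneg {ε : ℝ} (h0 : 0 < ε) (h1 : ε ≤ 1) : 0 ≤ Real.log (1 / √ε) :=
  Real.log_nonneg ((one_le_div (Real.sqrt_pos.2 h0)).2 (Real.sqrt_le_one.2 h1))

/-- In the constant, 2 pays for the ceiling and the additional run, and `1 / log 2` for the change
of base. -/
theorem searchRepetitions_le {η ε : ℝ} (hη : 0 < η) (hη1 : η ≤ 1) (h0 : 0 < ε) (h1 : ε ≤ 1) :
    (searchRepetitions η ε : ℝ) ≤
      (Real.logb 2 (2 / η) + 2 + 1 / Real.log 2) * (1 + Real.log (1 / √ε)) := by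
  have hs : 0 < √ε := Real.sqrt_pos.2 h0
  have hl := log_one_div_sqrt_nonneg h0 h1
  have hl2 : 0 < Real.log 2 := Real.log_pos (by norm_num)
  have h2 : 0 ≤ Real.logb 2 (2 / η) :=
    Real.logb_nonneg (by norm_num) ((one_le_div hη).2 (by linarith))
  have h3 : Real.logb 2 (2 / (√ε * η)) =
      Real.logb 2 (2 / η) + 1 / Real.log 2 * Real.log (1 / √ε) := by
    rw [show 2 / (√ε * η) = 2 / η * (1 / √ε) by field_simp,
      Real.logb_mul (by positivity) (by positivity), Real.logb, Real.logb]
    ring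
  have h4 := (Nat.ceil_lt_add_one
    (Real.logb_nonneg (b := 2) (by norm_num) (one_le_two_div hη hη1 h0 h1))).le
  rw [searchRepetitions]
  push_cast
  have h5 : 0 < 1 / Real.log 2 := by positivity
  rw [h3] at h4 ⊢
  nlinarith [mul_nonneg h2 hl]

/-- Here `I = 1/√ε`, `J = 1/√δ`, `L = 1 + log (1/√ε)` and `q = 2ˢ`; 272 is `17 * 16`. The single
update and the final check are absorbed because `I`, `J` and `L` are at least 1. -/
theorem total_cost_le {S U C I J L k q t r c₁ : ℝ} (hS : 0 ≤ S) (hU : 0 ≤ U) (hC : 0 ≤ C)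
    (hI : 1 ≤ I) (hJ : 1 ≤ J) (hL : 1 ≤ L) (hk0 : 0 ≤ k) (hk : k ≤ c₁ * L) (hq0 : 0 ≤ q)
    (hq : q ≤ 16 * J) (ht : t ≤ I) (hr : 0 ≤ r) (hc : 0 ≤ c₁) :
    r * (S + U + C + t * (C + 17 * (k * q * U))) ≤
      r * (2 + 272 * c₁) * (S + I * (J * L * U + C)) := by
  have h1 : 17 * (k * q * U) ≤ 272 * c₁ * (J * L * U) := by
    calc 17 * (k * q * U) ≤ 17 * ((c₁ * L) * (16 * J) * U) := by gcongr
      _ = _ := by ring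
  have h2 : t * (C + 17 * (k * q * U)) ≤ I * (C + 272 * c₁ * (J * L * U)) := by gcongr
  have h3 : U ≤ I * (J * L * U) := by
    rw [← mul_assoc]
    exact le_mul_of_one_le_left hU (one_le_mul_of_one_le_of_one_le hI
      (one_le_mul_of_one_le_of_one_le hJ hL))
  have h4 : C ≤ I * C := le_mul_of_one_le_left hC hI
  have h5 : 0 ≤ I * (J * L * U) := hU.trans h3
  have h6 : 0 ≤ I * C := hC.trans h4
  rw [mul_assoc r]
  refine mul_le_mul_of_nonneg_left ?_ hr
  nlinarith [mul_nonneg hc hS, mul_nonneg hc h6]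

theorem two_pow_phaseBits_le {X : Type*} [Fintype X] [DecidableEq X] [Nontrivial X]
    {P : Matrix X X ℝ} {π : X → ℝ} (hP : IsErgodicChain P) (hπ : IsStationaryDist P π)
    (hr : IsReversibleChain P π) :
    (2 : ℝ) ^ phaseBits (phaseGap P π) ≤ 16 * (1 / √(eigenvalueGap P)) := by
  obtain ⟨θ, hΔ, h0, h1, hδ, -⟩ := phaseGap_spec hP hπ hr
  have hδ0 := Real.sqrt_pos.2 hP.eigenvalueGap_pos
  rw [hΔ]
  refine (two_pow_phaseBits h0 h1).2.trans ?_
  rw [mul_one_div]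
  have := Real.pi_le_four
  gcongr
  linarith

end QuantumWalk

/-! ### The main theorem -/

theorem mainTheorem6 (η : ℝ) (hη : 0 < η) :
    ∃ (c : ℝ) (r : ℕ) (k t : ℝ → ℕ), 1 ≤ r ∧
      (∀ ε : ℝ, 0 < ε → ε ≤ 1 →
        1 ≤ k ε ∧ (k ε : ℝ) ≤ c * (1 + Real.log (1 / Real.sqrt ε)) ∧
        (t ε : ℝ) ≤ c * (1 / Real.sqrt ε)) ∧
      ∀ (X : Type*) [Fintype X] [DecidableEq X] [Nontrivial X]
        (P : Matrix X X ℝ) (π : X → ℝ) (_ : IsErgodicChain P) (_ : IsStationaryDist P π)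
        (_ : IsReversibleChain P π) (M : Finset X) (_ : M.Nonempty) (ε : ℝ)
        (_ : ε = ∑ x ∈ M, π x) (o : X) (V₁ V₂ : Matrix (X × X) (X × X) ℂ)
        (_ : IsUpdateA P o V₁) (_ : IsUpdateB P π o V₂) (s : ℕ)
        (_ : s = phaseBits (phaseGap P π)),
        -- the circuit for the controlled walk implements it
        (∀ q : Fin (k ε) × Fin s,
          circuitOp V₁ V₂ o M (ctrlWalk q) = controlled q (walk P π)) ∧
        -- the circuit `R(P)` is an approximate reflection through `|π⟩`
        circuitOp V₁ V₂ o M (approxReflection (k ε) s) *ᵥ withZeros _ (piState P π) =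
          withZeros _ (piState P π) ∧
        (∀ ψ ∈ spaceA P ⊔ spaceB P π, star (piState P π) ⬝ᵥ ψ = 0 →
          ‖WithLp.toLp 2 (circuitOp V₁ V₂ o M (approxReflection (k ε) s) *ᵥ withZeros _ ψ +
            withZeros _ ψ)‖ ≤ (1 / 2 : ℝ) ^ k ε * ‖WithLp.toLp 2 ψ‖) ∧
        -- the search succeeds with high probability
        max ε (1 - ε) - η ≤ successProb π V₁ V₂ o M (k ε) s (t ε) ∧
        -- a constant number of independent runs succeeds with probability close to one
        (1 - successProb π V₁ V₂ o M (k ε) s (t ε)) ^ r ≤ η ∧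
        -- the total cost of these runs, and in particular of a single one
        ∀ κ : Costs, r * searchCost κ (k ε) s (t ε) ≤
          c * (κ.setup + 1 / Real.sqrt ε *
            (1 / Real.sqrt (eigenvalueGap P) * (1 + Real.log (1 / Real.sqrt ε)) * κ.update +
              κ.checking)) := by

  -- The cap 1/4 keeps the success probability of one run at least `1/2 - 1/4`, so a run fails with
  -- probability at most 3/4 and `r` is a constant.
  set η' := min η (1 / 4) with hη'
  have hη0 : 0 < η' := lt_min hη (by norm_num)
  have hη1 : η' ≤ 1 / 4 := min_le_right _ _
  have hηη : η' ≤ η := min_le_left _ _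
  set c₁ := Real.logb 2 (2 / η') + 2 + 1 / Real.log 2 with hc₁
  have hl2 : 0 < Real.log 2 := Real.log_pos (by norm_num)
  have hc1 : 1 ≤ c₁ := by
    have h2 : 0 ≤ Real.logb 2 (2 / η') :=
      Real.logb_nonneg (by norm_num) ((one_le_div hη0).2 (by linarith))
    have h3 : 0 < 1 / Real.log 2 := by positivity
    linarith
  obtain ⟨r₀, hr₀⟩ := exists_pow_lt_of_lt_one hη (by norm_num : (3 / 4 : ℝ) < 1)
  set r := r₀ + 1 with hr
  have hr1 : (1 : ℝ) ≤ r := by rw [hr]; push_cast; linarith [Nat.cast_nonneg (α := ℝ) r₀]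
  have hrη : (3 / 4 : ℝ) ^ r ≤ η :=
    (pow_le_pow_of_le_one (by norm_num) (by norm_num) (Nat.le_succ r₀)).trans hr₀.le
  -- The cost constant thus also serves for `k` and `t`.
  have hcc : c₁ ≤ r * (2 + 272 * c₁) := by nlinarith
  have hc0 : 1 ≤ r * (2 + 272 * c₁) := hc1.trans hcc
  refine ⟨r * (2 + 272 * c₁), r, searchRepetitions η', searchIterations, Nat.succ_pos r₀, ?_, ?_⟩
  · intro ε h0 h1
    have hlog := log_one_div_sqrt_nonneg h0 h1
    refine ⟨Nat.succ_pos _, (searchRepetitions_le hη0 (by linarith) h0 h1).trans ?_,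
      (searchIterations_le h0 h1).trans (le_mul_of_one_le_left (by positivity) hc0)⟩
    exact mul_le_mul_of_nonneg_right hcc (by linarith)
  · intro X _ _ _ P π hP hπ hrev M hM ε hε o V₁ V₂ h₁ h₂ s hs
    have hk : 1 ≤ searchRepetitions η' ε := Nat.succ_pos _
    have h0 : 0 < ε := hε ▸ Finset.sum_pos (fun x _ => hP.stationary_pos hπ x) hM
    have h1 : ε ≤ 1 := by
      rw [hε, ← hπ.sum_eq_one]
      exact Finset.sum_le_sum_of_subset_of_nonneg (Finset.subset_univ M)
        fun x _ _ => hπ.nonneg x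
    have hsin : Real.sin (Real.arcsin √ε) ^ 2 = ε := by
      rw [Real.sin_arcsin (by linarith [Real.sqrt_nonneg ε]) (Real.sqrt_le_one.2 h1),
        Real.sq_sqrt h0.le]
    have hsucc : max ε (1 - ε) - η' ≤
        successProb π V₁ V₂ o M (searchRepetitions η' ε) s (searchIterations ε) := by
      have h3 := sin_sq_sub_le_successProb (M := M) hP hπ hrev h₁ h₂ hk hs hε hsin
        (searchIterations ε)
      linarith [max_le_sin_sq h0 h1, searchIterations_mul_le hη0 h0 h1]
    refine ⟨fun q => circuitOp_ctrlWalk h₁ h₂ q,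
      approxReflection_mulVec_fixed h₁ h₂ _ _ (walk_mulVec_piState hP hπ hrev),
      fun ψ hψ horth => norm_approxReflection_le hP hπ hrev h₁ h₂ hk hs
        (mem_busySpace_of_orthogonal hP hπ hrev hψ horth),
      by linarith, ?_, fun κ => ?_⟩
    · have h3 := successProb_le_one (M := M) hP hπ h₁ h₂.1 (searchRepetitions η' ε) s
        (searchIterations ε)
      refine (pow_le_pow_left₀ (by linarith) ?_ r).trans hrη
      have h4 : 1 / 2 ≤ max ε (1 - ε) := by
        rcases le_total (1 / 2) ε with h | h
        · exact le_max_of_le_left h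
        · exact le_max_of_le_right (by linarith)
      linarith
    · have hsq := Real.sqrt_pos.2 hP.eigenvalueGap_pos
      have hlog := log_one_div_sqrt_nonneg h0 h1
      refine (mul_le_mul_of_nonneg_left (searchCost_le κ hk _) (by linarith)).trans ?_
      refine total_cost_le κ.setup_nonneg κ.update_nonneg κ.checking_nonneg
        ((one_le_div (Real.sqrt_pos.2 h0)).2 (Real.sqrt_le_one.2 h1))
        ((one_le_div hsq).2 (Real.sqrt_le_one.2 (eigenvalueGap_le_one P))) (by linarith)
        (Nat.cast_nonneg _) (searchRepetitions_le hη0 (by linarith) h0 h1) (by positivity)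
        (hs ▸ two_pow_phaseBits_le hP hπ hrev) (searchIterations_le h0 h1)
        (by linarith) (by linarith)
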